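/- **Conventions.** A *strict $\infty$-category* $L$ is a graded set $L=\coprod_{n\ge 0}L^n$ with operations $d,c:L^{n+1}\to L^n$ (domain, codomain; $dc=dd$, $cd=cc$ on degrees $\ge 2$), $e:L^n\to L^{n+1}$ (identity; $de=ce=1$), and partial operations $f\circ_k g\in L^n$ for $f,g\in L^n$, $1\le k\le n$, defined iff $d^kf=c^kg$, such that: $d(f\circ_1 g)=dg$ and $c(f\circ_1 g)=cf$; for $k\ge 1$, $d(f\circ_{k+1}g)=df\circ_k dg$ and $c(f\circ_{k+1}g)=cf\circ_k cg$; $e(f\circ_k g)=ef\circ_{k+1}eg$; $f\circ_k e^kd^kf=f=e^kc^kf\circ_k f$; each $\circ_k$ is associative; and $(f\circ_j f')\circ_k(g\circ_j g')=(f\circ_k g)\circ_j(f'\circ_k g')$ for $j<k$. For $a,b\in L^0$ the hom-set $L(a,b)$, with $L^n(a,b)=\{f\in L^{n+1}: d^{n+1}f=a,\ c^{n+1}f=b\}$ and the operations of $L$, is again a strict $\infty$-category. $L^{op}$ is $L$ with $d,c$ exchanged on $L^1$ and $\circ_n$ reversed on $L^n$. For $f\in L^{n+1}$, $g\in L^{n+1}$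 put $f*g:=f\circ_{n+1}g$. The relation $\sim$ is the largest one such that $x\sim y$ implies that $x,y$ have the same degree and there are $f:x\to y$, $g:y\to x$ one degree higher with $ex\sim g\circ_1 f$ and $f\circ_1 g\sim ey$. A *functor* $F:L\to L'$ has degree $0$, preserves $d,c$ strictly, and preserves $e$ and all $\circ_k$ up to $\sim$; it is *strict* if it preserves $e$ and all $\circ_k$ up to $=$. A *strict isomorphism* is a strict functor with a two-sided inverse that is a strict functor. For $n\ge0$, an *$n$-modification* between functors $F,G:L\to L'$ is a family $\alpha(a)\in L'^{\,n}(F(a),G(a))$, $a\in L^0$, with $e^k\alpha(b)*F(f)\sim G(f)*e^k\alpha(a)$ for all $k\ge 0$, $f\in L^{k+n}(a,b)$, such that for $n\ge 1$ the families $a\mapsto d\alpha(a)$ and $a\mapsto c\alpha(a)$ are $(n-1)$-modifications. The universe $\infty\text{-CAT}$ has the strict $\infty$-categories in degree $0$, functors in degree $1$, and $n$-modifications in degree $n+2$; identities and composites inside $\infty\text{-CAT}(L,L')$ are componentwise, functors are composed as maps, and the horizontal composite of $n$-modifications $\alpha$ (from $G$ to $H$, functors $L'\to L''$) and $\beta$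 (from $F$ to $F'$, functors $L\to L'$) is $a\mapsto\alpha(F'(a))\circ_{n+1}G(\beta(a))$, whenever these are elements of $\infty\text{-CAT}$. Two parallel elements of $\infty\text{-CAT}$ of positive degree are *$\approx_1$-related* if all their values (for functors) or components (for modifications) are related by $\sim$. $\infty\text{-CAT}$-valued functors and $n$-modifications are defined as above with $\sim$ replaced by $\approx_1$; with componentwise operations those on $L^{op}$ form $\infty\text{-CAT}^{L^{op}}$ (functors in degree $0$, $n$-modifications in degree $n+1$). For $b\in L^0$, $L(-,b):L^{op}\to\infty\text{-CAT}$ sends $a\in L^0$ to $L(a,b)$, $f\in L^0(a,a')$ to the functor $L(a',b)\to L(a,b)$, $g\mapsto g*e^kf$ ($g\in L^k(a',b)$), and $f\in L^n(a,a')$, $n\ge1$, to the $(n-1)$-modification $x\mapsto e^nx*f$ ($x\in L^0(a',b)$). For $f\in L^n(a,b)$, $L(-,f)$ is the $n$-modification from $L(-,a)$ to $L(-,b)$ whose component at $x\in L^0$ is $L(x,f)$: the functor $g\mapsto e^kf*g$ ($g\in L^k(x,a)$) if $n=0$, and the $(n-1)$-modification $g\mapsto f*e^ng$ ($g\in L^0(x,a)$)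 if $n\ge 1$. **Proposition 3.4 (Yoneda embedding).** Let $L$ be a strict $\infty$-category. The assignment $\mathbf Y:\alpha\mapsto L(-,\alpha)$, $\alpha\in L$, is an injective strict functor $L\to\infty\text{-CAT}^{L^{op}}$. For all $a,b\in L^0$ it restricts to a strict isomorphism $L(a,b)\simeq\infty\text{-CAT}^{L^{op}}(L(-,a),L(-,b))$ whose inverse is the Yoneda isomorphism $\tau\mapsto\tau_a(ea)$. Moreover $\mathbf Y$ preserves and reflects equivalences: $x\sim y$ in $L$ if and only if $\mathbf Y(x)\sim\mathbf Y(y)$ in $\infty\text{-CAT}^{L^{op}}$, for all $x,y\in L$. -/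

import Mathlib

universe u v

/-- The data of an `∞`-precategory `L`: the graded set `L = ∐ Lⁿ` is given by the subsets `cell n`
of an ambient type `X`; `d`, `c`, `e` are the domain, codomain and identity operations, and
`comp k f g h` reads "`h` is the composite `f ∘ₖ g`".  Only the values on cells matter.  (The ambient
type is there so that the hom-sets `L(a, b)` are honest subsets of `L`, to be compared by `=`.) -/
structure InftyData where
  X : Type u
  cell : ℕ → Set X
  d : X → X
  c : X → X
  e : X → X
  comp : ℕ → X → X → X → Prop

/-- A map of graded sets from `L` to (the ambient type of) `K`. -/
abbrev GMap (L : InftyData.{u}) (K : InftyData.{v}) : Type (max u v) :=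
  ∀ n : ℕ, L.cell n → K.X

namespace InftyData

/-- `f, g, h ∈ Lⁿ`, `1 ≤ k ≤ n`, `dᵏ f = cᵏ g` and `h = f ∘ₖ g`. -/
def IsComp (L : InftyData.{u}) (n k : ℕ) (f g h : L.X) : Prop :=
  (f ∈ L.cell n ∧ g ∈ L.cell n ∧ h ∈ L.cell n) ∧ (1 ≤ k ∧ k ≤ n) ∧
    L.d^[k] f = L.c^[k] g ∧ L.comp k f g h

/-- Strict `∞`-categories. -/
structure IsStrict (L : InftyData.{u}) : Prop where
  deg_unique : ∀ m n x, x ∈ L.cell m → x ∈ L.cell n → m = n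
  d_mem : ∀ n x, x ∈ L.cell (n + 1) → L.d x ∈ L.cell n
  c_mem : ∀ n x, x ∈ L.cell (n + 1) → L.c x ∈ L.cell n
  e_mem : ∀ n x, x ∈ L.cell n → L.e x ∈ L.cell (n + 1)
  d_c : ∀ n x, x ∈ L.cell (n + 2) → L.d (L.c x) = L.d (L.d x)
  c_d : ∀ n x, x ∈ L.cell (n + 2) → L.c (L.d x) = L.c (L.c x)
  d_e : ∀ n x, x ∈ L.cell n → L.d (L.e x) = x
  c_e : ∀ n x, x ∈ L.cell n → L.c (L.e x) = x
  /-- `f ∘ₖ g` is determined as soon as `dᵏ f = cᵏ g` -/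
  comp_exists : ∀ n k f g, f ∈ L.cell n → g ∈ L.cell n → 1 ≤ k → k ≤ n →
    L.d^[k] f = L.c^[k] g → ∃ h, L.IsComp n k f g h
  comp_unique : ∀ n k f g h h', L.IsComp n k f g h → L.IsComp n k f g h' → h = h'
  /-- domain and codomain of `f ∘₁ g` -/
  d_comp_one : ∀ n f g h, L.IsComp n 1 f g h → L.d h = L.d g
  c_comp_one : ∀ n f g h, L.IsComp n 1 f g h → L.c h = L.c f
  /-- `d (f ∘ₖ₊₁ g) = d f ∘ₖ d g` and `c (f ∘ₖ₊₁ g) = c f ∘ₖ c g` for `k ≥ 1` -/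
  d_comp : ∀ n k f g h, 1 ≤ k → L.IsComp (n + 1) (k + 1) f g h →
    L.IsComp n k (L.d f) (L.d g) (L.d h)
  c_comp : ∀ n k f g h, 1 ≤ k → L.IsComp (n + 1) (k + 1) f g h →
    L.IsComp n k (L.c f) (L.c g) (L.c h)
  /-- horizontal composites preserve identities: `e (f ∘ₖ g) = e f ∘ₖ₊₁ e g` -/
  e_comp : ∀ n k f g h, L.IsComp n k f g h → L.IsComp (n + 1) (k + 1) (L.e f) (L.e g) (L.e h)
  /-- unit laws -/
  comp_unit : ∀ n k f, f ∈ L.cell n → 1 ≤ k → k ≤ n →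
    L.IsComp n k f (L.e^[k] (L.d^[k] f)) f
  unit_comp : ∀ n k f, f ∈ L.cell n → 1 ≤ k → k ≤ n →
    L.IsComp n k (L.e^[k] (L.c^[k] f)) f f
  /-- associativity: `(f ∘ₖ g) ∘ₖ h = f ∘ₖ (g ∘ₖ h)` -/
  assoc : ∀ n k f g h p q r, L.IsComp n k f g p → L.IsComp n k p h r → L.IsComp n k g h q →
    L.IsComp n k f q r
  /-- interchange: `(f ∘ⱼ f') ∘ₖ (g ∘ⱼ g') = (f ∘ₖ g) ∘ⱼ (f' ∘ₖ g')` for `j < k` -/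
  interchange : ∀ n j k f f' g g' p q r s t, j < k →
    L.IsComp n j f f' p → L.IsComp n j g g' q → L.IsComp n k p q t →
    L.IsComp n k f g r → L.IsComp n k f' g' s → L.IsComp n j r s t

/-- `R` is a family of equivalence data: related elements `x, y` have the same degree and there are
arrows `f : x → y`, `g : y → x` such that again `e x` is related to `g ∘₁ f` and `f ∘₁ g` to `e y`. -/
def IsSimulation (L : InftyData.{u}) (R : L.X → L.X → Prop) : Prop :=
  ∀ x y, R x y → ∃ n f g p q,
    (x ∈ L.cell n ∧ y ∈ L.cell n) ∧
    (f ∈ L.cell (n + 1) ∧ L.d f = x ∧ L.c f = y) ∧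
    (g ∈ L.cell (n + 1) ∧ L.d g = y ∧ L.c g = x) ∧
    L.IsComp (n + 1) 1 g f p ∧ L.IsComp (n + 1) 1 f g q ∧ R (L.e x) p ∧ R q (L.e y)

/-- The equivalence `x ∼ y`: there are `f : x → y` and `g : y → x` with `e x ∼ g ∘₁ f` and
`f ∘₁ g ∼ e y`, and so on through all higher orders (the largest such relation). -/
def Sim (L : InftyData.{u}) (x y : L.X) : Prop :=
  ∃ R : L.X → L.X → Prop, L.IsSimulation R ∧ R x y

/-- The hom-set `L(a, b)` of objects `a, b ∈ L⁰`, with `Lⁿ(a, b) = {f ∈ Lⁿ⁺¹ | a = dⁿ⁺¹ f, b = cⁿ⁺¹ f}`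
and with the operations of `L`. -/
abbrev Hom (L : InftyData.{u}) (a b : L.X) : InftyData.{u} where
  X := L.X
  cell n := {f | f ∈ L.cell (n + 1) ∧ L.d^[n + 1] f = a ∧ L.c^[n + 1] f = b}
  d := L.d
  c := L.c
  e := L.e
  comp := L.comp

open Classical in
/-- The opposite `Lᵒᵖ`: arrows of degree `1`, and composites `∘ₙ` of elements of `Lⁿ`, are reversed. -/
noncomputable abbrev Op (L : InftyData.{u}) : InftyData.{u} where
  X := L.X
  cell := L.cell
  d x := if x ∈ L.cell 1 then L.c x else L.d x
  c x := if x ∈ L.cell 1 then L.d x else L.c x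
  e := L.e
  comp k f g h := if f ∈ L.cell k then L.comp k g f h else L.comp k f g h

open Classical in
/-- The composite `f ∘ₖ g` of `f, g ∈ Lⁿ` as an element (junk value `f` if it is not determined). -/
noncomputable def circ (L : InftyData.{u}) (n k : ℕ) (f g : L.X) : L.X :=
  if h : ∃ r, L.IsComp n k f g r then h.choose else f

end InftyData

/-- `∞`-functors `F : L → K`: `d` and `c` are preserved strictly, `e` and the composites up to `R`.
`R` is `∼` for functors between `∞`-categories, `≈₁` for `∞-CAT`-valued ones, `=` for strict ones. -/
structure IsFunctor (L : InftyData.{u}) (K : InftyData.{v}) (R : K.X → K.X → Prop)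
    (F : GMap L K) : Prop where
  mem : ∀ n (x : L.cell n), F n x ∈ K.cell n
  map_d : ∀ n (x : L.cell (n + 1)) (y : L.cell n), y.1 = L.d x.1 → F n y = K.d (F (n + 1) x)
  map_c : ∀ n (x : L.cell (n + 1)) (y : L.cell n), y.1 = L.c x.1 → F n y = K.c (F (n + 1) x)
  map_e : ∀ n (x : L.cell n) (y : L.cell (n + 1)), y.1 = L.e x.1 →
    R (F (n + 1) y) (K.e (F n x))
  map_comp : ∀ n k (x y z : L.cell n), L.IsComp n k x.1 y.1 z.1 →
    ∃ w, K.IsComp n k (F n x) (F n y) w ∧ R (F n z) w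

/-- The components `α(a) ∈ Kⁿ(F a, G a)`, `a ∈ L⁰`, of an `n`-modification and its naturality
`eᵏ α(b) * F f ∼ G f * eᵏ α(a)` for all `f ∈ Lᵏ⁺ⁿ(a, b)`, `k ≥ 0` (with `R` in the place of `∼`). -/
structure IsNatural (L : InftyData.{u}) (K : InftyData.{v}) (R : K.X → K.X → Prop)
    (F G : GMap L K) (n : ℕ) (α : L.cell 0 → K.X) : Prop where
  mem : ∀ a, α a ∈ K.cell (n + 1)
  dom : ∀ a, K.d^[n + 1] (α a) = F 0 a
  cod : ∀ a, K.c^[n + 1] (α a) = G 0 a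
  natural : ∀ (k : ℕ) (a b : L.cell 0) (f : L.cell (k + n + 1)),
    L.d^[k + n + 1] f.1 = a.1 → L.c^[k + n + 1] f.1 = b.1 →
    ∃ p q, K.IsComp (k + n + 1) (k + n + 1) (K.e^[k] (α b)) (F (k + n + 1) f) p ∧
      K.IsComp (k + n + 1) (k + n + 1) (G (k + n + 1) f) (K.e^[k] (α a)) q ∧ R p q

/-- `n`-modifications between functors `F` and `G`: the domain `a ↦ d (α a)` and the codomain
`a ↦ c (α a)` of an `(n+1)`-modification are `n`-modifications. -/
def IsModification (L : InftyData.{u}) (K : InftyData.{v}) (R : K.X → K.X → Prop)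
    (F G : GMap L K) : ℕ → (L.cell 0 → K.X) → Prop
  | 0, α => IsNatural L K R F G 0 α
  | n + 1, α => IsNatural L K R F G (n + 1) α ∧
      IsModification L K R F G n (fun a => K.d (α a)) ∧
      IsModification L K R F G n (fun a => K.c (α a))

/-- Underlying data of the elements of a functor category: maps, and families `α` (for
`n`-modifications) together with their domain and codomain functors `F` and `G`. -/
inductive FunCell (L : InftyData.{u}) (K : InftyData.{v}) : Type (max u v)
  | fn (F : GMap L K) : FunCell L K
  | mod (n : ℕ) (F G : GMap L K) (α : L.cell 0 → K.X) : FunCell L K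

namespace FunCell

variable {L : InftyData.{u}} {K : InftyData.{v}}

def d : FunCell L K → FunCell L K
  | fn F => fn F
  | mod 0 F _ _ => fn F
  | mod (n + 1) F G α => mod n F G (fun a => K.d (α a))

def c : FunCell L K → FunCell L K
  | fn F => fn F
  | mod 0 _ G _ => fn G
  | mod (n + 1) F G α => mod n F G (fun a => K.c (α a))

def e : FunCell L K → FunCell L K
  | fn F => mod 0 F F (fun a => K.e (F 0 a))
  | mod n F G α => mod (n + 1) F G (fun a => K.e (α a))

/-- Composites of modifications are taken componentwise. -/
inductive Comp : ℕ → FunCell L K → FunCell L K → FunCell L K → Prop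
  | mod (n k : ℕ) (F G F' G' : GMap L K) (α β γ : L.cell 0 → K.X)
      (h : ∀ a, K.IsComp (n + 1) k (α a) (β a) (γ a)) :
      Comp k (mod n F' G α) (mod n F G' β) (mod n F G γ)

/-- Functors have degree `0`, `n`-modifications have degree `n + 1`. -/
def IsCell (R : K.X → K.X → Prop) : ℕ → FunCell L K → Prop
  | 0, fn F => IsFunctor L K R F
  | n + 1, mod m F G α =>
      m = n ∧ IsFunctor L K R F ∧ IsFunctor L K R G ∧ IsModification L K R F G m α
  | 0, mod _ _ _ _ => False
  | _ + 1, fn _ => False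

end FunCell

/-- The functor category `Kᴸ`: functors `L → K` (up to `R`) and their modifications. -/
abbrev FunCat (L : InftyData.{u}) (K : InftyData.{v}) (R : K.X → K.X → Prop) :
    InftyData.{max u v} where
  X := FunCell L K
  cell n := {x | FunCell.IsCell R n x}
  d := FunCell.d
  c := FunCell.c
  e := FunCell.e
  comp := FunCell.Comp

/-- Underlying data of the elements of `∞-CAT`. -/
inductive CatCell : Type (u + 1)
  | obj (L : InftyData.{u}) : CatCell
  | arr (L L' : InftyData.{u}) (x : FunCell L L') : CatCell

namespace CatCell

def d : CatCell.{u} → CatCell.{u}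
  | obj L => obj L
  | arr L _ (.fn _) => obj L
  | arr L L' (.mod n F G α) => arr L L' (FunCell.mod n F G α).d

def c : CatCell.{u} → CatCell.{u}
  | obj L => obj L
  | arr _ L' (.fn _) => obj L'
  | arr L L' (.mod n F G α) => arr L L' (FunCell.mod n F G α).c

def e : CatCell.{u} → CatCell.{u}
  | obj L => arr L L (.fn fun _ x => x.1)
  | arr L L' x => arr L L' x.e

/-- Composites in `∞-CAT`: componentwise inside `∞-CAT(L, L')`, the composite of functors, and
the horizontal composite `a ↦ α (F' a) ∘ₙ₊₁ G (β a)` of the `n`-modifications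
`β` (from `F` to `F'`, functors `L → L'`) and `α` (from `G` to `H`, functors `L' → L''`). -/
inductive Comp : ℕ → CatCell.{u} → CatCell.{u} → CatCell.{u} → Prop
  | vert (n k : ℕ) (L L' : InftyData.{u}) (x y z : FunCell L L')
      (h : (FunCat L L' L'.Sim).IsComp n k x y z) :
      Comp k (arr L L' x) (arr L L' y) (arr L L' z)
  | fn (L L' L'' : InftyData.{u}) (G : GMap L' L'') (F : GMap L L') (P : GMap L L'')
      (hP : ∀ m x y, y.1 = F m x → P m x = G m y) :
      Comp 1 (arr L' L'' (.fn G)) (arr L L' (.fn F)) (arr L L'' (.fn P))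
  | horiz (n : ℕ) (L L' L'' : InftyData.{u}) (G H : GMap L' L'') (α : L'.cell 0 → L''.X)
      (F F' : GMap L L') (β : L.cell 0 → L'.X) (P Q : GMap L L'') (γ : L.cell 0 → L''.X)
      (hP : ∀ m x y, y.1 = F m x → P m x = G m y)
      (hQ : ∀ m x y, y.1 = F' m x → Q m x = H m y)
      (hγ : ∀ (a : L.cell 0) (b : L'.cell 0) (w : L'.cell (n + 1)),
        b.1 = F' 0 a → w.1 = β a → L''.IsComp (n + 1) (n + 1) (α b) (G (n + 1) w) (γ a)) :
      Comp (n + 2) (arr L' L'' (.mod n G H α)) (arr L L' (.mod n F F' β))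
        (arr L L'' (.mod n P Q γ))

/-- Degree `0`: categories; degree `1`: functors; degree `n + 2`: `n`-modifications. -/
def IsCell : ℕ → CatCell.{u} → Prop
  | 0, obj L => L.IsStrict
  | n + 1, arr L L' x => L.IsStrict ∧ L'.IsStrict ∧ x ∈ (FunCat L L' L'.Sim).cell n
  | 0, arr _ _ _ => False
  | _ + 1, obj _ => False

/-- `x ≈₁ y`: the values (for functors), or components (for modifications), of `x` and `y` are
equivalent. -/
inductive Approx : CatCell.{u} → CatCell.{u} → Prop
  | fn (L L' : InftyData.{u}) (F G : GMap L L') (h : ∀ n x, L'.Sim (F n x) (G n x)) :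
      Approx (arr L L' (.fn F)) (arr L L' (.fn G))
  | mod (L L' : InftyData.{u}) (n : ℕ) (F G : GMap L L') (α β : L.cell 0 → L'.X)
      (h : ∀ a, L'.Sim (α a) (β a)) :
      Approx (arr L L' (.mod n F G α)) (arr L L' (.mod n F G β))

end CatCell

/-- `∞-CAT`, the universe of categories, functors and `n`-modifications. -/
abbrev InftyCAT : InftyData.{u + 1} where
  X := CatCell.{u}
  cell n := {x | CatCell.IsCell n x}
  d := CatCell.d
  c := CatCell.c
  e := CatCell.e
  comp := CatCell.Comp

namespace InftyData

/-- The category `∞-CAT^{Lᵒᵖ}` of `∞-CAT`-valued functors on `Lᵒᵖ` and their modifications. -/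
noncomputable abbrev Presheaf (L : InftyData.{u}) : InftyData.{u + 1} :=
  FunCat L.Op InftyCAT.{u} CatCell.Approx

variable (L : InftyData.{u})

/-- For `f : a → a'`, the functor `L(f, b) : L(a', b) → L(a, b)`, `g ↦ g * eᵏ f` on `Lᵏ(a', b)`. -/
noncomputable def preFn (a a' b f : L.X) : GMap (L.Hom a' b) (L.Hom a b) :=
  fun k g => L.circ (k + 1) (k + 1) g.1 (L.e^[k] f)

/-- `L(f, b)` for `f ∈ Lⁿ(a, a')`; for `n ≥ 1` it is the modification `g ↦ eⁿ g * f`. -/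
noncomputable def preCell (a a' b : L.X) : ℕ → L.X → FunCell (L.Hom a' b) (L.Hom a b)
  | 0, f => .fn (L.preFn a a' b f)
  | n + 1, f => .mod n (L.preFn a a' b (L.d^[n + 1] f)) (L.preFn a a' b (L.c^[n + 1] f))
      (fun g => L.circ (n + 2) (n + 2) (L.e^[n + 1] g.1) f)

/-- For `f : b → b'`, the functor `L(a, f) : L(a, b) → L(a, b')`, `g ↦ eᵏ f * g` on `Lᵏ(a, b)`. -/
noncomputable def postFn (a b b' f : L.X) : GMap (L.Hom a b) (L.Hom a b') :=
  fun k g => L.circ (k + 1) (k + 1) (L.e^[k] f) g.1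

/-- `L(a, f)` for `f ∈ Lⁿ(b, b')`; for `n ≥ 1` it is the modification `g ↦ f * eⁿ g`. -/
noncomputable def postCell (a b b' : L.X) : ℕ → L.X → FunCell (L.Hom a b) (L.Hom a b')
  | 0, f => .fn (L.postFn a b b' f)
  | n + 1, f => .mod n (L.postFn a b b' (L.d^[n + 1] f)) (L.postFn a b b' (L.c^[n + 1] f))
      (fun g => L.circ (n + 2) (n + 2) f (L.e^[n + 1] g.1))

/-- The contravariant hom-functor `L(-, b) : Lᵒᵖ → ∞-CAT`. -/
noncomputable def homFunctor (b : L.X) : GMap L.Op InftyCAT.{u}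
  | 0, x => .obj (L.Hom x.1 b)
  | n + 1, f => .arr (L.Hom (L.c^[n + 1] f.1) b) (L.Hom (L.d^[n + 1] f.1) b)
      (L.preCell (L.d^[n + 1] f.1) (L.c^[n + 1] f.1) b n f.1)

/-- The Yoneda map `α ↦ L(-, α)`: the functor `L(-, a)` for an object `a`, and for `f ∈ Lⁿ(a, b)` the
`n`-modification from `L(-, a)` to `L(-, b)` with components `L(x, f)`. -/
noncomputable def yoneda : GMap L L.Presheaf
  | 0, a => .fn (L.homFunctor a.1)
  | n + 1, f => .mod n (L.homFunctor (L.d^[n + 1] f.1)) (L.homFunctor (L.c^[n + 1] f.1))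
      (fun x => .arr (L.Hom x.1 (L.d^[n + 1] f.1)) (L.Hom x.1 (L.c^[n + 1] f.1))
        (L.postCell x.1 (L.d^[n + 1] f.1) (L.c^[n + 1] f.1) n f.1))

/-- The restriction `L(a, b) → ∞-CAT^{Lᵒᵖ}(L(-, a), L(-, b))` of the Yoneda map. -/
noncomputable def yonedaHom (a b : L.cell 0) :
    GMap (L.Hom a.1 b.1) (L.Presheaf.Hom (L.yoneda 0 a) (L.yoneda 0 b)) :=
  fun n f => L.yoneda (n + 1) ⟨f.1, f.2.1⟩

/-- `UnitValue L a b τ y`: the `n`-modification `τ` from `L(-, a)` to `L(-, b)` has `τ_a(e a) = y`.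
The component `τ_a` is a functor if `n = 0`, and an `(n-1)`-modification if `n ≥ 1`. -/
inductive UnitValue (a b : L.cell 0) : FunCell L.Op InftyCAT.{u} → L.X → Prop
  | fn (P Q : GMap L.Op InftyCAT.{u}) (τ : L.Op.cell 0 → CatCell.{u})
      (T : GMap (L.Hom a.1 a.1) (L.Hom a.1 b.1)) (w : (L.Hom a.1 a.1).cell 0)
      (hτ : τ a = .arr (L.Hom a.1 a.1) (L.Hom a.1 b.1) (.fn T)) (hw : w.1 = L.e a.1) :
      UnitValue a b (.mod 0 P Q τ) (T 0 w)
  | mod (n : ℕ) (P Q : GMap L.Op InftyCAT.{u}) (τ : L.Op.cell 0 → CatCell.{u})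
      (F G : GMap (L.Hom a.1 a.1) (L.Hom a.1 b.1))
      (β : (L.Hom a.1 a.1).cell 0 → (L.Hom a.1 b.1).X) (w : (L.Hom a.1 a.1).cell 0)
      (hτ : τ a = .arr (L.Hom a.1 a.1) (L.Hom a.1 b.1) (.mod n F G β)) (hw : w.1 = L.e a.1) :
      UnitValue a b (.mod (n + 1) P Q τ) (β w)

end InftyData

/-- `F` and `G` are mutually inverse strict functors. -/
structure IsStrictIso (L : InftyData.{u}) (K : InftyData.{v}) (F : GMap L K) (G : GMap K L) :
    Prop where
  functor : IsFunctor L K Eq F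
  inv_functor : IsFunctor K L Eq G
  left_inv : ∀ n (x : L.cell n) (y : K.cell n), y.1 = F n x → G n y = x.1
  right_inv : ∀ n (y : K.cell n) (x : L.cell n), x.1 = G n y → F n x = y.1

/-!
The composition of `L` is a strict functor of two variables `L(b, c) × L(a, b) → L(a, c)`; this is
the interchange law (`InftyData.IsStrict.isBifunctor_star`). Everything about the cells `L(f, b)`
and `L(a, f)` of `∞-CAT` is an instance of facts about a strict functor `B : K₁ × K₂ → K₃`
(`IsBifunctor`): an element `f ∈ K₂ⁿ` determines the section `B(-, f)`, a functor `K₁ → K₃` if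
`n = 0` and an `(n-1)`-modification if `n ≥ 1`, and `f ↦ B(-, f)` preserves all the operations.
Naturality of the section holds because both sides of the naturality square at `h` are `B(h, eᵏ f)`,
by the unit laws and the functoriality of `B`. For the same reason the horizontal composite of
`B(-, f)` and `B'(-, f')` is the section `B'(B(-, f), f')` of an iterated functor
(`IsBifunctor.hcomp_arr`), so that the associativity of composition yields the functoriality
of `L(-, b)` and of the Yoneda map, and the naturality of `L(-, f)`.

The Yoneda map is injective since `L(a, f)` takes `e a` to `f`. For surjectivity on hom-sets
(`InftyData.exists_eq_postArr`), let `τ` be a modification from `L(-, a)` to `L(-, b)`. Its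
naturality is only required up to `≈₁`, but it is also required at identities `e h`, and there it
says that two elements of the form `e y` and `e y'` of a hom-set are equivalent. Equivalent elements
are parallel, whence `y = y'`: naturality holds strictly. Evaluating at `e a` gives
`τ_x(g) = τ_a(e a) * eⁿ g` (or `eᵏ τ_a(e a) * g` for `g` of degree `k`, if `n = 0`) as usual.

Strict functors preserve equivalences (`IsFunctor.map_sim`). Conversely, the equivalence data
between two elements in the image of the Yoneda map lie in hom-sets between representable functors,
so they come from `L`, and composites of elements of `L` are read off from values at `e a`
(`InftyData.IsStrict.sim_of_sim_yoneda`).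
-/

/-! ### Strict `∞`-categories -/

namespace InftyData

variable {L : InftyData.{u}}

theorem IsComp.to_hom {a b : L.X} {n k : ℕ} {f g h : L.X} (H : (L.Hom a b).IsComp n k f g h) :
    L.IsComp (n + 1) k f g h :=
  ⟨⟨H.1.1.1, H.1.2.1.1, H.1.2.2.1⟩, ⟨H.2.1.1, Nat.le_succ_of_le H.2.1.2⟩, H.2.2⟩

namespace IsStrict

theorem iterate_d_mem (hL : L.IsStrict) {m k : ℕ} {x : L.X} (hx : x ∈ L.cell (m + k)) :
    L.d^[k] x ∈ L.cell m := by
  induction k generalizing x with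
  | zero => exact hx
  | succ k ih => exact ih (hL.d_mem _ _ hx)

theorem iterate_c_mem (hL : L.IsStrict) {m k : ℕ} {x : L.X} (hx : x ∈ L.cell (m + k)) :
    L.c^[k] x ∈ L.cell m := by
  induction k generalizing x with
  | zero => exact hx
  | succ k ih => exact ih (hL.c_mem _ _ hx)

theorem iterate_e_mem (hL : L.IsStrict) {m : ℕ} (k : ℕ) {x : L.X} (hx : x ∈ L.cell m) :
    L.e^[k] x ∈ L.cell (m + k) := by
  induction k with
  | zero => exact hx
  | succ k ih =>
    rw [Function.iterate_succ_apply']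
    exact hL.e_mem _ _ ih

theorem d_iterate_c (hL : L.IsStrict) {m k : ℕ} {x : L.X} (hx : x ∈ L.cell (m + 1 + k)) :
    L.d (L.c^[k] x) = L.d^[k + 1] x := by
  induction k generalizing x with
  | zero => rfl
  | succ k ih =>
    have := ih (hL.c_mem _ _ hx)
    rw [show m + 1 + (k + 1) = m + k + 2 by omega] at hx
    rw [Function.iterate_succ_apply, this, Function.iterate_succ_apply,
      Function.iterate_succ_apply, Function.iterate_succ_apply,
      hL.d_c (m + k) x hx]

theorem c_iterate_d (hL : L.IsStrict) {m k : ℕ} {x : L.X} (hx : x ∈ L.cell (m + 1 + k)) :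
    L.c (L.d^[k] x) = L.c^[k + 1] x := by
  induction k generalizing x with
  | zero => rfl
  | succ k ih =>
    have := ih (hL.d_mem _ _ hx)
    rw [show m + 1 + (k + 1) = m + k + 2 by omega] at hx
    rw [Function.iterate_succ_apply, this, Function.iterate_succ_apply,
      Function.iterate_succ_apply, Function.iterate_succ_apply,
      hL.c_d (m + k) x hx]

theorem iterate_d_iterate_c (hL : L.IsStrict) {n j k : ℕ} {x : L.X} (hx : x ∈ L.cell n)
    (hj : 1 ≤ j) (hn : j + k ≤ n) : L.d^[j] (L.c^[k] x) = L.d^[j + k] x := by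
  obtain ⟨j, rfl⟩ := Nat.exists_eq_add_of_le' hj
  obtain ⟨m, rfl⟩ := Nat.exists_eq_add_of_le' hn
  rw [show m + (j + 1 + k) = m + j + 1 + k by omega] at hx
  rw [Function.iterate_succ_apply, hL.d_iterate_c hx, ← Function.iterate_add_apply,
    show j + 1 + k = j + (k + 1) by omega]

theorem iterate_c_iterate_d (hL : L.IsStrict) {n j k : ℕ} {x : L.X} (hx : x ∈ L.cell n)
    (hj : 1 ≤ j) (hn : j + k ≤ n) : L.c^[j] (L.d^[k] x) = L.c^[j + k] x := by
  obtain ⟨j, rfl⟩ := Nat.exists_eq_add_of_le' hj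
  obtain ⟨m, rfl⟩ := Nat.exists_eq_add_of_le' hn
  rw [show m + (j + 1 + k) = m + j + 1 + k by omega] at hx
  rw [Function.iterate_succ_apply, hL.c_iterate_d hx, ← Function.iterate_add_apply,
    show j + 1 + k = j + (k + 1) by omega]

theorem iterate_d_c (hL : L.IsStrict) {n : ℕ} {x : L.X} (hx : x ∈ L.cell (n + 2)) :
    L.d^[n + 1] (L.c x) = L.d^[n + 2] x :=
  hL.iterate_d_iterate_c (k := 1) hx (Nat.succ_pos n) le_rfl

theorem iterate_c_d (hL : L.IsStrict) {n : ℕ} {x : L.X} (hx : x ∈ L.cell (n + 2)) :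
    L.c^[n + 1] (L.d x) = L.c^[n + 2] x :=
  hL.iterate_c_iterate_d (k := 1) hx (Nat.succ_pos n) le_rfl

theorem iterate_d_iterate_e (hL : L.IsStrict) {m : ℕ} (k j : ℕ) {x : L.X} (hx : x ∈ L.cell m) :
    L.d^[k] (L.e^[j + k] x) = L.e^[j] x := by
  induction k with
  | zero => rfl
  | succ k ih =>
    rw [← Nat.add_assoc, Function.iterate_succ_apply, Function.iterate_succ_apply',
      hL.d_e _ _ (hL.iterate_e_mem _ hx), ih]

theorem iterate_c_iterate_e (hL : L.IsStrict) {m : ℕ} (k j : ℕ) {x : L.X} (hx : x ∈ L.cell m) :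
    L.c^[k] (L.e^[j + k] x) = L.e^[j] x := by
  induction k with
  | zero => rfl
  | succ k ih =>
    rw [← Nat.add_assoc, Function.iterate_succ_apply, Function.iterate_succ_apply',
      hL.c_e _ _ (hL.iterate_e_mem _ hx), ih]

theorem iterate_d_iterate_e_self (hL : L.IsStrict) {m : ℕ} (k : ℕ) {x : L.X}
    (hx : x ∈ L.cell m) : L.d^[k] (L.e^[k] x) = x := by
  simpa using hL.iterate_d_iterate_e k 0 hx

theorem iterate_c_iterate_e_self (hL : L.IsStrict) {m : ℕ} (k : ℕ) {x : L.X}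
    (hx : x ∈ L.cell m) : L.c^[k] (L.e^[k] x) = x := by
  simpa using hL.iterate_c_iterate_e k 0 hx

/-- The extremal faces of a composite `h = f ∘ₖ g`. -/
theorem faces_comp (hL : L.IsStrict) {n k : ℕ} {f g h : L.X} (H : L.IsComp n k f g h) :
    L.d^[k] h = L.d^[k] g ∧ L.c^[k] h = L.c^[k] f := by
  induction k generalizing n f g h with
  | zero => exact absurd H.2.1.1 (by simp)
  | succ k ih =>
    rcases Nat.eq_zero_or_pos k with rfl | hk
    · exact ⟨hL.d_comp_one _ _ _ _ H, hL.c_comp_one _ _ _ _ H⟩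
    · obtain ⟨n, rfl⟩ := Nat.exists_eq_add_of_le' (le_trans (Nat.le_add_left 1 k) H.2.1.2)
      exact ⟨(ih (hL.d_comp _ _ _ _ _ hk H)).1, (ih (hL.c_comp _ _ _ _ _ hk H)).2⟩

/-- Elements that are composable along a positive-dimensional face have the same end points. -/
theorem endpoints_eq (hL : L.IsStrict) {n k m : ℕ} {f g : L.X} (hf : f ∈ L.cell n)
    (hg : g ∈ L.cell n) (hkm : k < m) (hm : m ≤ n) (h : L.d^[k] f = L.c^[k] g) :
    L.d^[m] f = L.d^[m] g ∧ L.c^[m] f = L.c^[m] g := by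
  obtain ⟨j, rfl⟩ := Nat.exists_eq_add_of_le' hkm.le
  constructor
  · rw [Function.iterate_add_apply, h, hL.iterate_d_iterate_c hg (by omega) hm]
  · rw [← hL.iterate_c_iterate_d hf (by omega) hm, h, ← Function.iterate_add_apply]

theorem endpoints_comp (hL : L.IsStrict) {n k m : ℕ} {f g h : L.X} (H : L.IsComp n k f g h)
    (hkm : k < m) (hm : m ≤ n) : L.d^[m] h = L.d^[m] f ∧ L.c^[m] h = L.c^[m] f := by
  have h1 := hL.endpoints_eq H.1.1 H.1.2.1 hkm hm H.2.2.1
  have h2 := hL.faces_comp H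
  obtain ⟨j, rfl⟩ := Nat.exists_eq_add_of_le' hkm.le
  constructor
  · rw [h1.1, Function.iterate_add_apply, h2.1, ← Function.iterate_add_apply]
  · rw [Function.iterate_add_apply, h2.2, ← Function.iterate_add_apply]

theorem faces_comp_of_le (hL : L.IsStrict) {n k m : ℕ} {f g h : L.X} (H : L.IsComp n k f g h)
    (hkm : k ≤ m) (hm : m ≤ n) : L.d^[m] h = L.d^[m] g ∧ L.c^[m] h = L.c^[m] f := by
  obtain ⟨j, rfl⟩ := Nat.exists_eq_add_of_le' hkm
  simp only [Function.iterate_add_apply, hL.faces_comp H, and_self]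

theorem isComp_circ (hL : L.IsStrict) {n k : ℕ} {f g : L.X} (hf : f ∈ L.cell n)
    (hg : g ∈ L.cell n) (h1 : 1 ≤ k) (h2 : k ≤ n) (h : L.d^[k] f = L.c^[k] g) :
    L.IsComp n k f g (L.circ n k f g) := by
  have H := hL.comp_exists n k f g hf hg h1 h2 h
  rw [circ, dif_pos H]
  exact H.choose_spec

theorem circ_eq (hL : L.IsStrict) {n k : ℕ} {f g h : L.X} (H : L.IsComp n k f g h) :
    L.circ n k f g = h :=
  hL.comp_unique _ _ _ _ _ _ (hL.isComp_circ H.1.1 H.1.2.1 H.2.1.1 H.2.1.2 H.2.2.1) H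

/-- `f ∘ₖ eᵏ z = f` whenever the composite is defined. -/
theorem eq_of_comp_id (hL : L.IsStrict) {m n k : ℕ} {f z h : L.X} (hz : z ∈ L.cell m)
    (H : L.IsComp n k f (L.e^[k] z) h) : h = f := by
  have hd : L.d^[k] f = z := H.2.2.1.trans (hL.iterate_c_iterate_e_self k hz)
  refine hL.comp_unique _ _ _ _ _ _ H ?_
  have := hL.comp_unit n k f H.1.1 H.2.1.1 H.2.1.2
  rwa [hd] at this

/-- `eᵏ z ∘ₖ f = f` whenever the composite is defined. -/
theorem eq_of_id_comp (hL : L.IsStrict) {m n k : ℕ} {f z h : L.X} (hz : z ∈ L.cell m)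
    (H : L.IsComp n k (L.e^[k] z) f h) : h = f := by
  have hc : L.c^[k] f = z := H.2.2.1.symm.trans (hL.iterate_d_iterate_e_self k hz)
  refine hL.comp_unique _ _ _ _ _ _ H ?_
  have := hL.unit_comp n k f H.1.2.1 H.2.1.1 H.2.1.2
  rwa [hc] at this

/-- An iterated identity is idempotent. -/
theorem id_comp_id (hL : L.IsStrict) {m n k : ℕ} {z : L.X} (hz : z ∈ L.cell m)
    (h1 : 1 ≤ k) (h2 : k ≤ n) :
    L.IsComp (m + n) k (L.e^[n] z) (L.e^[n] z) (L.e^[n] z) := by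
  obtain ⟨j, rfl⟩ := Nat.exists_eq_add_of_le' h2
  have := hL.comp_unit (m + (j + k)) k (L.e^[j + k] z) (hL.iterate_e_mem _ hz) h1 (by omega)
  rwa [hL.iterate_d_iterate_e k j hz, ← Function.iterate_add_apply, Nat.add_comm k j] at this

/-- It is enough to know the end points of one factor: those of the other factor and of the
composite agree with them, since `k ≤ n`. -/
theorem isComp_hom (hL : L.IsStrict) {a b : L.X} {n k : ℕ} {f g h : L.X}
    (H : L.IsComp (n + 1) k f g h) (hk : k ≤ n) (hf : f ∈ (L.Hom a b).cell n) :
    (L.Hom a b).IsComp n k f g h := by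
  have h1 := hL.endpoints_eq H.1.1 H.1.2.1 (Nat.lt_succ_of_le hk) le_rfl H.2.2.1
  have h2 := hL.endpoints_comp H (Nat.lt_succ_of_le hk) le_rfl
  exact ⟨⟨hf, ⟨H.1.2.1, h1.1.symm.trans hf.2.1, h1.2.symm.trans hf.2.2⟩,
    ⟨H.1.2.2, h2.1.trans hf.2.1, h2.2.trans hf.2.2⟩⟩, ⟨H.2.1.1, hk⟩, H.2.2⟩

theorem hom_d_mem (hL : L.IsStrict) {a b : L.X} {n : ℕ} {x : L.X}
    (hx : x ∈ (L.Hom a b).cell (n + 1)) : L.d x ∈ (L.Hom a b).cell n :=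
  ⟨hL.d_mem _ _ hx.1, hx.2.1, (hL.iterate_c_d hx.1).trans hx.2.2⟩

theorem hom_c_mem (hL : L.IsStrict) {a b : L.X} {n : ℕ} {x : L.X}
    (hx : x ∈ (L.Hom a b).cell (n + 1)) : L.c x ∈ (L.Hom a b).cell n :=
  ⟨hL.c_mem _ _ hx.1, (hL.iterate_d_c hx.1).trans hx.2.1, hx.2.2⟩

/-- The hom-sets of a strict `∞`-category are strict `∞`-categories. -/
theorem hom (hL : L.IsStrict) (a b : L.X) : (L.Hom a b).IsStrict where
  deg_unique m n x hm hn := Nat.succ_injective (hL.deg_unique _ _ x hm.1 hn.1)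
  d_mem n x hx := hL.hom_d_mem hx
  c_mem n x hx := hL.hom_c_mem hx
  e_mem n x hx := ⟨hL.e_mem _ _ hx.1, by
    rw [Function.iterate_succ_apply, hL.d_e _ _ hx.1, hx.2.1], by
    rw [Function.iterate_succ_apply, hL.c_e _ _ hx.1, hx.2.2]⟩
  d_c n x hx := hL.d_c _ _ hx.1
  c_d n x hx := hL.c_d _ _ hx.1
  d_e n x hx := hL.d_e _ _ hx.1
  c_e n x hx := hL.c_e _ _ hx.1
  comp_exists n k f g hf hg h1 h2 h := by
    obtain ⟨r, hr⟩ := hL.comp_exists (n + 1) k f g hf.1 hg.1 h1 (Nat.le_succ_of_le h2) h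
    exact ⟨r, hL.isComp_hom hr h2 hf⟩
  comp_unique n k f g h h' H H' := hL.comp_unique _ _ _ _ _ _ H.to_hom H'.to_hom
  d_comp_one n f g h H := hL.d_comp_one _ _ _ _ H.to_hom
  c_comp_one n f g h H := hL.c_comp_one _ _ _ _ H.to_hom
  d_comp n k f g h hk H := hL.isComp_hom (hL.d_comp _ _ _ _ _ hk H.to_hom)
    (Nat.le_of_succ_le_succ H.2.1.2) (hL.hom_d_mem H.1.1)
  c_comp n k f g h hk H := hL.isComp_hom (hL.c_comp _ _ _ _ _ hk H.to_hom)
    (Nat.le_of_succ_le_succ H.2.1.2) (hL.hom_c_mem H.1.1)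
  e_comp n k f g h H := by
    refine hL.isComp_hom (hL.e_comp _ _ _ _ _ H.to_hom) (Nat.succ_le_succ H.2.1.2)
      ⟨hL.e_mem _ _ H.1.1.1, ?_, ?_⟩
    · rw [Function.iterate_succ_apply, hL.d_e _ _ H.1.1.1, H.1.1.2.1]
    · rw [Function.iterate_succ_apply, hL.c_e _ _ H.1.1.1, H.1.1.2.2]
  comp_unit n k f hf h1 h2 :=
    hL.isComp_hom (hL.comp_unit _ _ f hf.1 h1 (Nat.le_succ_of_le h2)) h2 hf
  unit_comp n k f hf h1 h2 := by
    have H := hL.unit_comp _ _ f hf.1 h1 (Nat.le_succ_of_le h2)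
    have h3 := hL.endpoints_eq H.1.1 H.1.2.1 (Nat.lt_succ_of_le h2) le_rfl H.2.2.1
    exact hL.isComp_hom H h2 ⟨H.1.1, h3.1.trans hf.2.1, h3.2.trans hf.2.2⟩
  assoc n k f g h p q r H₁ H₂ H₃ :=
    hL.isComp_hom (hL.assoc _ _ _ _ _ _ _ _ H₁.to_hom H₂.to_hom H₃.to_hom) H₁.2.1.2 H₁.1.1
  interchange n j k f f' g g' p q r s t hjk H₁ H₂ H₃ H₄ H₅ :=
    hL.isComp_hom (hL.interchange _ _ _ _ _ _ _ _ _ _ _ _ hjk H₁.to_hom H₂.to_hom H₃.to_hom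
      H₄.to_hom H₅.to_hom) H₁.2.1.2 H₄.1.2.2

theorem sim_refl (hL : L.IsStrict) {n : ℕ} {x : L.X} (hx : x ∈ L.cell n) : L.Sim x x := by
  refine ⟨fun x y => x = y ∧ ∃ n, x ∈ L.cell n, ?_, rfl, n, hx⟩
  rintro x _ ⟨rfl, n, hx⟩
  have he := hL.e_mem n x hx
  have hc : L.IsComp (n + 1) 1 (L.e x) (L.e x) (L.e x) := by
    simpa using hL.id_comp_id (n := 1) hx le_rfl le_rfl
  exact ⟨n, L.e x, L.e x, L.e x, L.e x, ⟨hx, hx⟩, ⟨he, hL.d_e _ _ hx, hL.c_e _ _ hx⟩,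
    ⟨he, hL.d_e _ _ hx, hL.c_e _ _ hx⟩, hc, hc, ⟨rfl, _, he⟩,
    ⟨rfl, _, he⟩⟩

/-- Equivalent elements of positive degree are parallel. -/
theorem d_eq_of_sim (hL : L.IsStrict) {n : ℕ} {x y : L.X} (hx : x ∈ L.cell (n + 1))
    (h : L.Sim x y) : L.d x = L.d y := by
  obtain ⟨R, hR, hxy⟩ := h
  obtain ⟨m, f, -, -, -, ⟨hx', -⟩, ⟨hf, rfl, rfl⟩, -⟩ := hR x y hxy
  obtain rfl := hL.deg_unique _ _ _ hx hx'
  exact (hL.d_c _ _ hf).symm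

end IsStrict

end InftyData

/-! ### Sections of strict functors of two variables -/

/-- `B` is a strict functor of two variables `K₁ × K₂ → K₃` between strict `∞`-categories; the
first argument of `B` is the degree.  Like `circ`, `B` is a total map, of which only the values on
pairs of cells of the given degree matter. -/
structure IsBifunctor (K₁ K₂ K₃ : InftyData.{u}) (B : ℕ → K₁.X → K₂.X → K₃.X) : Prop where
  strict₁ : K₁.IsStrict
  strict₂ : K₂.IsStrict
  strict₃ : K₃.IsStrict
  mem : ∀ n x y, x ∈ K₁.cell n → y ∈ K₂.cell n → B n x y ∈ K₃.cell n
  map_d : ∀ n x y, x ∈ K₁.cell (n + 1) → y ∈ K₂.cell (n + 1) →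
    K₃.d (B (n + 1) x y) = B n (K₁.d x) (K₂.d y)
  map_c : ∀ n x y, x ∈ K₁.cell (n + 1) → y ∈ K₂.cell (n + 1) →
    K₃.c (B (n + 1) x y) = B n (K₁.c x) (K₂.c y)
  map_e : ∀ n x y, x ∈ K₁.cell n → y ∈ K₂.cell n →
    K₃.e (B n x y) = B (n + 1) (K₁.e x) (K₂.e y)
  map_comp : ∀ n k x x' x'' y y' y'', K₁.IsComp n k x x' x'' → K₂.IsComp n k y y' y'' →
    K₃.IsComp n k (B n x y) (B n x' y') (B n x'' y'')

/-- The functor `B(-, f) : K₁ → K₃` given by an object `f` of `K₂`. -/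
def sectionFn (K₁ K₂ K₃ : InftyData.{u}) (B : ℕ → K₁.X → K₂.X → K₃.X) (f : K₂.X) : GMap K₁ K₃ :=
  fun k g => B k g.1 (K₂.e^[k] f)

/-- The section `B(-, f)` determined by `f ∈ K₂ⁿ`: a functor `K₁ → K₃` if `n = 0`, and the
`(n-1)`-modification with components `B(eⁿ g, f)`, `g ∈ K₁⁰`, if `n ≥ 1`. -/
def sectionCell (K₁ K₂ K₃ : InftyData.{u}) (B : ℕ → K₁.X → K₂.X → K₃.X) :
    ℕ → K₂.X → FunCell K₁ K₃
  | 0, f => .fn (sectionFn K₁ K₂ K₃ B f)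
  | n + 1, f => .mod n (sectionFn K₁ K₂ K₃ B (K₂.d^[n + 1] f))
      (sectionFn K₁ K₂ K₃ B (K₂.c^[n + 1] f)) (fun g => B (n + 1) (K₁.e^[n + 1] g.1) f)

/-- `B(-, f)` as an element of `∞-CAT`. -/
def sectionArr (K₁ K₂ K₃ : InftyData.{u}) (B : ℕ → K₁.X → K₂.X → K₃.X) (n : ℕ) (f : K₂.X) :
    CatCell.{u} :=
  .arr K₁ K₃ (sectionCell K₁ K₂ K₃ B n f)

namespace IsBifunctor

variable {K₁ K₂ K₃ : InftyData.{u}} {B : ℕ → K₁.X → K₂.X → K₃.X}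

theorem flip (hB : IsBifunctor K₁ K₂ K₃ B) : IsBifunctor K₂ K₁ K₃ fun n y x => B n x y where
  strict₁ := hB.strict₂
  strict₂ := hB.strict₁
  strict₃ := hB.strict₃
  mem n x y hx hy := hB.mem n y x hy hx
  map_d n x y hx hy := hB.map_d n y x hy hx
  map_c n x y hx hy := hB.map_c n y x hy hx
  map_e n x y hx hy := hB.map_e n y x hy hx
  map_comp _ _ _ _ _ _ _ _ hx hy := hB.map_comp _ _ _ _ _ _ _ _ hy hx

theorem iterate_d (hB : IsBifunctor K₁ K₂ K₃ B) {n k : ℕ} {x : K₁.X} {y : K₂.X}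
    (hx : x ∈ K₁.cell (n + k)) (hy : y ∈ K₂.cell (n + k)) :
    K₃.d^[k] (B (n + k) x y) = B n (K₁.d^[k] x) (K₂.d^[k] y) := by
  induction k generalizing x y with
  | zero => rfl
  | succ k ih =>
    simp only [Function.iterate_succ_apply]
    rw [← ih (hB.strict₁.d_mem _ _ hx) (hB.strict₂.d_mem _ _ hy)]
    exact congrArg K₃.d^[k] (hB.map_d _ _ _ hx hy)

theorem iterate_c (hB : IsBifunctor K₁ K₂ K₃ B) {n k : ℕ} {x : K₁.X} {y : K₂.X}
    (hx : x ∈ K₁.cell (n + k)) (hy : y ∈ K₂.cell (n + k)) :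
    K₃.c^[k] (B (n + k) x y) = B n (K₁.c^[k] x) (K₂.c^[k] y) := by
  induction k generalizing x y with
  | zero => rfl
  | succ k ih =>
    simp only [Function.iterate_succ_apply]
    rw [← ih (hB.strict₁.c_mem _ _ hx) (hB.strict₂.c_mem _ _ hy)]
    exact congrArg K₃.c^[k] (hB.map_c _ _ _ hx hy)

theorem iterate_e (hB : IsBifunctor K₁ K₂ K₃ B) {n : ℕ} (k : ℕ) {x : K₁.X} {y : K₂.X}
    (hx : x ∈ K₁.cell n) (hy : y ∈ K₂.cell n) :
    K₃.e^[k] (B n x y) = B (n + k) (K₁.e^[k] x) (K₂.e^[k] y) := by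
  induction k with
  | zero => rfl
  | succ k ih =>
    simp only [Function.iterate_succ_apply']
    rw [ih, hB.map_e _ _ _ (hB.strict₁.iterate_e_mem _ hx) (hB.strict₂.iterate_e_mem _ hy)]
    rfl

/-- `B(x, y)` as the composite of `B(x, -)` at the domain of `y` with `B(-, y)` at the codomain of
`x`. -/
theorem comp_left (hB : IsBifunctor K₁ K₂ K₃ B) {n k : ℕ} {x : K₁.X} {y : K₂.X}
    (hx : x ∈ K₁.cell n) (hy : y ∈ K₂.cell n) (h1 : 1 ≤ k) (h2 : k ≤ n) :
    K₃.IsComp n k (B n (K₁.e^[k] (K₁.c^[k] x)) y) (B n x (K₂.e^[k] (K₂.d^[k] y))) (B n x y) :=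
  hB.map_comp _ _ _ _ _ _ _ _ (hB.strict₁.unit_comp n k x hx h1 h2)
    (hB.strict₂.comp_unit n k y hy h1 h2)

/-- `B(x, y)` as the composite of `B(-, y)` at the domain of `x` with `B(x, -)` at the codomain of
`y`. -/
theorem comp_right (hB : IsBifunctor K₁ K₂ K₃ B) {n k : ℕ} {x : K₁.X} {y : K₂.X}
    (hx : x ∈ K₁.cell n) (hy : y ∈ K₂.cell n) (h1 : 1 ≤ k) (h2 : k ≤ n) :
    K₃.IsComp n k (B n x (K₂.e^[k] (K₂.c^[k] y))) (B n (K₁.e^[k] (K₁.d^[k] x)) y) (B n x y) :=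
  hB.flip.comp_left hy hx h1 h2

theorem isFunctor_section (hB : IsBifunctor K₁ K₂ K₃ B) {f : K₂.X} (hf : f ∈ K₂.cell 0) :
    IsFunctor K₁ K₃ K₃.Sim (sectionFn K₁ K₂ K₃ B f) := by
  have he : ∀ n, K₂.e^[n] f ∈ K₂.cell n := fun n => by
    simpa using hB.strict₂.iterate_e_mem n hf
  have hm : ∀ n (x : K₁.cell n), sectionFn K₁ K₂ K₃ B f n x ∈ K₃.cell n :=
    fun n x => hB.mem _ _ _ x.2 (he n)
  refine ⟨hm, ?_, ?_, ?_, ?_⟩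
  · rintro n x y hy
    simp only [sectionFn]
    rw [hB.map_d _ _ _ x.2 (he _), ← hy, Function.iterate_succ_apply', hB.strict₂.d_e _ _ (he n)]
  · rintro n x y hy
    simp only [sectionFn]
    rw [hB.map_c _ _ _ x.2 (he _), ← hy, Function.iterate_succ_apply', hB.strict₂.c_e _ _ (he n)]
  · rintro n x y hy
    have : sectionFn K₁ K₂ K₃ B f (n + 1) y = K₃.e (sectionFn K₁ K₂ K₃ B f n x) := by
      simp only [sectionFn]
      rw [hB.map_e _ _ _ x.2 (he _), hy, Function.iterate_succ_apply']
    rw [← this]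
    exact hB.strict₃.sim_refl (hm _ y)
  · rintro n k x y z h
    refine ⟨_, hB.map_comp _ _ _ _ _ _ _ _ h ?_, hB.strict₃.sim_refl (hm _ z)⟩
    simpa using hB.strict₂.id_comp_id hf h.2.1.1 h.2.1.2

theorem isNatural_section (hB : IsBifunctor K₁ K₂ K₃ B) {n : ℕ} {f : K₂.X}
    (hf : f ∈ K₂.cell (n + 1)) :
    IsNatural K₁ K₃ K₃.Sim (sectionFn K₁ K₂ K₃ B (K₂.d^[n + 1] f))
      (sectionFn K₁ K₂ K₃ B (K₂.c^[n + 1] f)) n (fun g => B (n + 1) (K₁.e^[n + 1] g.1) f) := by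
  have hf' : f ∈ K₂.cell (0 + (n + 1)) := by rwa [Nat.zero_add]
  have he : ∀ (k : ℕ) (g : K₁.cell 0), K₁.e^[k] g.1 ∈ K₁.cell (0 + k) := fun k g =>
    hB.strict₁.iterate_e_mem k g.2
  refine ⟨fun g => ?_, fun g => ?_, fun g => ?_, fun k x y h hx hy => ?_⟩
  · simpa using hB.mem _ _ _ (he (n + 1) g) hf'
  · have := hB.iterate_d (he (n + 1) g) hf'
    rwa [hB.strict₁.iterate_d_iterate_e_self _ g.2, Nat.zero_add] at this
  · have := hB.iterate_c (he (n + 1) g) hf'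
    rwa [hB.strict₁.iterate_c_iterate_e_self _ g.2, Nat.zero_add] at this
  · -- both sides of the naturality condition are `B(h, eᵏ f)`
    have hk : K₂.e^[k] f ∈ K₂.cell (k + n + 1) := by
      have := hB.strict₂.iterate_e_mem k hf
      rwa [Nat.add_comm, ← Nat.add_assoc] at this
    have hd : K₂.d^[k + n + 1] (K₂.e^[k] f) = K₂.d^[n + 1] f := by
      rw [show k + n + 1 = n + 1 + k by omega, Function.iterate_add_apply,
        hB.strict₂.iterate_d_iterate_e_self _ hf]
    have hc : K₂.c^[k + n + 1] (K₂.e^[k] f) = K₂.c^[n + 1] f := by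
      rw [show k + n + 1 = n + 1 + k by omega, Function.iterate_add_apply,
        hB.strict₂.iterate_c_iterate_e_self _ hf]
    have hcell : ∀ g : K₁.cell 0, K₃.e^[k] (B (n + 1) (K₁.e^[n + 1] g.1) f) =
        B (k + n + 1) (K₁.e^[k + n + 1] g.1) (K₂.e^[k] f) := fun g => by
      have h0 : K₁.e^[n + 1] g.1 ∈ K₁.cell (n + 1) := by simpa using he (n + 1) g
      rw [hB.iterate_e k h0 hf, ← Function.iterate_add_apply]
      congr 1
      · omega
    refine ⟨_, _, ?_, ?_, hB.strict₃.sim_refl (hB.mem _ _ _ h.2 hk)⟩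
    · have := hB.comp_left h.2 hk (Nat.le_add_left 1 (k + n)) le_rfl
      rwa [hd, hy, ← hcell] at this
    · have := hB.comp_right h.2 hk (Nat.le_add_left 1 (k + n)) le_rfl
      rwa [hc, hx, ← hcell] at this

theorem d_section_component (hB : IsBifunctor K₁ K₂ K₃ B) {n : ℕ} {f : K₂.X}
    (hf : f ∈ K₂.cell (n + 1)) {g : K₁.X} (hg : g ∈ K₁.cell 0) :
    K₃.d (B (n + 1) (K₁.e^[n + 1] g) f) = B n (K₁.e^[n] g) (K₂.d f) := by
  have h0 : K₁.e^[n + 1] g ∈ K₁.cell (n + 1) := by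
    simpa using hB.strict₁.iterate_e_mem (n + 1) hg
  rw [hB.map_d _ _ _ h0 hf, Function.iterate_succ_apply',
    hB.strict₁.d_e _ _ (hB.strict₁.iterate_e_mem n hg)]

theorem c_section_component (hB : IsBifunctor K₁ K₂ K₃ B) {n : ℕ} {f : K₂.X}
    (hf : f ∈ K₂.cell (n + 1)) {g : K₁.X} (hg : g ∈ K₁.cell 0) :
    K₃.c (B (n + 1) (K₁.e^[n + 1] g) f) = B n (K₁.e^[n] g) (K₂.c f) := by
  have h0 : K₁.e^[n + 1] g ∈ K₁.cell (n + 1) := by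
    simpa using hB.strict₁.iterate_e_mem (n + 1) hg
  rw [hB.map_c _ _ _ h0 hf, Function.iterate_succ_apply',
    hB.strict₁.c_e _ _ (hB.strict₁.iterate_e_mem n hg)]

theorem isModification_section (hB : IsBifunctor K₁ K₂ K₃ B) {n : ℕ} {f : K₂.X}
    (hf : f ∈ K₂.cell (n + 1)) :
    IsModification K₁ K₃ K₃.Sim (sectionFn K₁ K₂ K₃ B (K₂.d^[n + 1] f))
      (sectionFn K₁ K₂ K₃ B (K₂.c^[n + 1] f)) n (fun g => B (n + 1) (K₁.e^[n + 1] g.1) f) := by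
  induction n generalizing f with
  | zero => exact hB.isNatural_section hf
  | succ n ih =>
    refine ⟨hB.isNatural_section hf, ?_, ?_⟩
    · have := ih (hB.strict₂.d_mem _ _ hf)
      rw [hB.strict₂.iterate_c_d hf] at this
      simp only [hB.d_section_component hf (Subtype.prop _)]
      exact this
    · have := ih (hB.strict₂.c_mem _ _ hf)
      rw [hB.strict₂.iterate_d_c hf] at this
      simp only [hB.c_section_component hf (Subtype.prop _)]
      exact this

theorem section_mem (hB : IsBifunctor K₁ K₂ K₃ B) {n : ℕ} {f : K₂.X} (hf : f ∈ K₂.cell n) :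
    sectionCell K₁ K₂ K₃ B n f ∈ (FunCat K₁ K₃ K₃.Sim).cell n := by
  cases n with
  | zero => exact hB.isFunctor_section hf
  | succ n =>
    have hf' : f ∈ K₂.cell (0 + (n + 1)) := by rwa [Nat.zero_add]
    exact ⟨rfl, hB.isFunctor_section (hB.strict₂.iterate_d_mem hf'),
      hB.isFunctor_section (hB.strict₂.iterate_c_mem hf'), hB.isModification_section hf⟩

theorem d_section (hB : IsBifunctor K₁ K₂ K₃ B) {n : ℕ} {f : K₂.X} (hf : f ∈ K₂.cell (n + 1)) :
    (sectionCell K₁ K₂ K₃ B (n + 1) f).d = sectionCell K₁ K₂ K₃ B n (K₂.d f) := by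
  cases n with
  | zero => rfl
  | succ n =>
    simp only [sectionCell, FunCell.d, hB.d_section_component hf (Subtype.prop _)]
    rw [hB.strict₂.iterate_c_d hf]
    rfl

theorem c_section (hB : IsBifunctor K₁ K₂ K₃ B) {n : ℕ} {f : K₂.X} (hf : f ∈ K₂.cell (n + 1)) :
    (sectionCell K₁ K₂ K₃ B (n + 1) f).c = sectionCell K₁ K₂ K₃ B n (K₂.c f) := by
  cases n with
  | zero => rfl
  | succ n =>
    simp only [sectionCell, FunCell.c, hB.c_section_component hf (Subtype.prop _)]
    rw [hB.strict₂.iterate_d_c hf]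
    rfl

theorem e_section (hB : IsBifunctor K₁ K₂ K₃ B) {n : ℕ} {f : K₂.X} (hf : f ∈ K₂.cell n) :
    (sectionCell K₁ K₂ K₃ B n f).e = sectionCell K₁ K₂ K₃ B (n + 1) (K₂.e f) := by
  cases n with
  | zero =>
    simp only [sectionCell, FunCell.e, sectionFn, Function.iterate_succ_apply,
      Function.iterate_zero_apply, hB.strict₂.d_e _ _ hf, hB.strict₂.c_e _ _ hf,
      hB.map_e _ _ _ (Subtype.prop _) hf]
  | succ n =>
    have h0 : ∀ g : K₁.cell 0, K₁.e^[n + 1] g.1 ∈ K₁.cell (n + 1) := fun g => by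
      simpa using hB.strict₁.iterate_e_mem (n + 1) g.2
    simp only [sectionCell, FunCell.e, hB.map_e _ _ _ (h0 _) hf]
    rw [Function.iterate_succ_apply K₂.d (n + 1), Function.iterate_succ_apply K₂.c (n + 1),
      hB.strict₂.d_e _ _ hf, hB.strict₂.c_e _ _ hf]
    simp only [Function.iterate_succ_apply']

theorem iterate_d_section (hB : IsBifunctor K₁ K₂ K₃ B) {n k : ℕ} {f : K₂.X}
    (hf : f ∈ K₂.cell (n + k)) :
    FunCell.d^[k] (sectionCell K₁ K₂ K₃ B (n + k) f) = sectionCell K₁ K₂ K₃ B n (K₂.d^[k] f) := by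
  induction k generalizing f with
  | zero => rfl
  | succ k ih =>
    rw [Function.iterate_succ_apply, Function.iterate_succ_apply,
      ← ih (hB.strict₂.d_mem _ _ hf)]
    exact congrArg FunCell.d^[k] (hB.d_section hf)

theorem iterate_c_section (hB : IsBifunctor K₁ K₂ K₃ B) {n k : ℕ} {f : K₂.X}
    (hf : f ∈ K₂.cell (n + k)) :
    FunCell.c^[k] (sectionCell K₁ K₂ K₃ B (n + k) f) = sectionCell K₁ K₂ K₃ B n (K₂.c^[k] f) := by
  induction k generalizing f with
  | zero => rfl
  | succ k ih =>
    rw [Function.iterate_succ_apply, Function.iterate_succ_apply,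
      ← ih (hB.strict₂.c_mem _ _ hf)]
    exact congrArg FunCell.c^[k] (hB.c_section hf)

/-- `f ↦ B(-, f)` preserves composites. -/
theorem comp_section (hB : IsBifunctor K₁ K₂ K₃ B) {n k : ℕ} {f g h : K₂.X}
    (H : K₂.IsComp n k f g h) :
    (FunCat K₁ K₃ K₃.Sim).IsComp n k (sectionCell K₁ K₂ K₃ B n f) (sectionCell K₁ K₂ K₃ B n g)
      (sectionCell K₁ K₂ K₃ B n h) := by
  refine ⟨⟨hB.section_mem H.1.1, hB.section_mem H.1.2.1, hB.section_mem H.1.2.2⟩, H.2.1, ?_, ?_⟩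
  · obtain ⟨m, rfl⟩ := Nat.exists_eq_add_of_le' H.2.1.2
    have h1 := hB.iterate_d_section H.1.1
    have h2 := hB.iterate_c_section H.1.2.1
    rw [H.2.2.1, ← h2] at h1
    exact h1
  · cases n with
    | zero => exact absurd (H.2.1.1.trans H.2.1.2) (by simp)
    | succ n =>
      have hfaces := hB.strict₂.faces_comp_of_le H H.2.1.2 le_rfl
      simp only [sectionCell, hfaces.1, hfaces.2]
      refine FunCell.Comp.mod n k _ _ _ _ _ _ _ fun a => hB.map_comp _ _ _ _ _ _ _ _ ?_ H
      simpa using hB.strict₁.id_comp_id (n := n + 1) a.2 H.2.1.1 H.2.1.2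

/-! ### Sections in the universe of categories -/

theorem arr_mem (hB : IsBifunctor K₁ K₂ K₃ B) {n : ℕ} {f : K₂.X} (hf : f ∈ K₂.cell n) :
    sectionArr K₁ K₂ K₃ B n f ∈ InftyCAT.cell (n + 1) :=
  ⟨hB.strict₁, hB.strict₃, hB.section_mem hf⟩

theorem d_arr (hB : IsBifunctor K₁ K₂ K₃ B) {n : ℕ} {f : K₂.X} (hf : f ∈ K₂.cell (n + 1)) :
    CatCell.d (sectionArr K₁ K₂ K₃ B (n + 1) f) = sectionArr K₁ K₂ K₃ B n (K₂.d f) :=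
  congrArg (CatCell.arr K₁ K₃) (hB.d_section hf)

theorem c_arr (hB : IsBifunctor K₁ K₂ K₃ B) {n : ℕ} {f : K₂.X} (hf : f ∈ K₂.cell (n + 1)) :
    CatCell.c (sectionArr K₁ K₂ K₃ B (n + 1) f) = sectionArr K₁ K₂ K₃ B n (K₂.c f) :=
  congrArg (CatCell.arr K₁ K₃) (hB.c_section hf)

theorem e_arr (hB : IsBifunctor K₁ K₂ K₃ B) {n : ℕ} {f : K₂.X} (hf : f ∈ K₂.cell n) :
    CatCell.e (sectionArr K₁ K₂ K₃ B n f) = sectionArr K₁ K₂ K₃ B (n + 1) (K₂.e f) :=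
  congrArg (CatCell.arr K₁ K₃) (hB.e_section hf)

theorem iterate_e_arr (hB : IsBifunctor K₁ K₂ K₃ B) {n : ℕ} (k : ℕ) {f : K₂.X}
    (hf : f ∈ K₂.cell n) :
    CatCell.e^[k] (sectionArr K₁ K₂ K₃ B n f) = sectionArr K₁ K₂ K₃ B (n + k) (K₂.e^[k] f) := by
  induction k with
  | zero => rfl
  | succ k ih =>
    rw [Function.iterate_succ_apply', ih, hB.e_arr (hB.strict₂.iterate_e_mem _ hf),
      Function.iterate_succ_apply']
    rfl

theorem iterate_d_arr (hB : IsBifunctor K₁ K₂ K₃ B) {n k : ℕ} {f : K₂.X}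
    (hf : f ∈ K₂.cell (n + k)) :
    CatCell.d^[k] (sectionArr K₁ K₂ K₃ B (n + k) f) = sectionArr K₁ K₂ K₃ B n (K₂.d^[k] f) := by
  induction k generalizing f with
  | zero => rfl
  | succ k ih =>
    rw [Function.iterate_succ_apply, Function.iterate_succ_apply,
      ← ih (hB.strict₂.d_mem _ _ hf)]
    exact congrArg CatCell.d^[k] (hB.d_arr hf)

theorem iterate_c_arr (hB : IsBifunctor K₁ K₂ K₃ B) {n k : ℕ} {f : K₂.X}
    (hf : f ∈ K₂.cell (n + k)) :
    CatCell.c^[k] (sectionArr K₁ K₂ K₃ B (n + k) f) = sectionArr K₁ K₂ K₃ B n (K₂.c^[k] f) := by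
  induction k generalizing f with
  | zero => rfl
  | succ k ih =>
    rw [Function.iterate_succ_apply, Function.iterate_succ_apply,
      ← ih (hB.strict₂.c_mem _ _ hf)]
    exact congrArg CatCell.c^[k] (hB.c_arr hf)

theorem dom_arr (hB : IsBifunctor K₁ K₂ K₃ B) {n : ℕ} {f : K₂.X} (hf : f ∈ K₂.cell n) :
    CatCell.d^[n + 1] (sectionArr K₁ K₂ K₃ B n f) = .obj K₁ := by
  have := hB.iterate_d_arr (n := 0) (k := n) (by rwa [Nat.zero_add])
  rw [Nat.zero_add] at this
  rw [Function.iterate_succ_apply', this]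
  rfl

theorem cod_arr (hB : IsBifunctor K₁ K₂ K₃ B) {n : ℕ} {f : K₂.X} (hf : f ∈ K₂.cell n) :
    CatCell.c^[n + 1] (sectionArr K₁ K₂ K₃ B n f) = .obj K₃ := by
  have := hB.iterate_c_arr (n := 0) (k := n) (by rwa [Nat.zero_add])
  rw [Nat.zero_add] at this
  rw [Function.iterate_succ_apply', this]
  rfl

theorem comp_arr (hB : IsBifunctor K₁ K₂ K₃ B) {n k : ℕ} {f g h : K₂.X}
    (H : K₂.IsComp n k f g h) :
    InftyCAT.IsComp (n + 1) k (sectionArr K₁ K₂ K₃ B n f) (sectionArr K₁ K₂ K₃ B n g)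
      (sectionArr K₁ K₂ K₃ B n h) := by
  refine ⟨⟨hB.arr_mem H.1.1, hB.arr_mem H.1.2.1, hB.arr_mem H.1.2.2⟩,
    ⟨H.2.1.1, Nat.le_succ_of_le H.2.1.2⟩, ?_, .vert n k K₁ K₃ _ _ _ (hB.comp_section H)⟩
  obtain ⟨m, rfl⟩ := Nat.exists_eq_add_of_le' H.2.1.2
  have h1 := hB.iterate_d_arr H.1.1
  have h2 := hB.iterate_c_arr H.1.2.1
  rw [H.2.2.1, ← h2] at h1
  exact h1

end IsBifunctor

/-! ### Products and iterated functors of two variables -/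

namespace InftyData

/-- The product of two `∞`-categories. -/
abbrev prod (K₁ K₂ : InftyData.{u}) : InftyData.{u} where
  X := K₁.X × K₂.X
  cell n := {p | p.1 ∈ K₁.cell n ∧ p.2 ∈ K₂.cell n}
  d := Prod.map K₁.d K₂.d
  c := Prod.map K₁.c K₂.c
  e := Prod.map K₁.e K₂.e
  comp k p q r := K₁.comp k p.1 q.1 r.1 ∧ K₂.comp k p.2 q.2 r.2

variable {K₁ K₂ : InftyData.{u}}

theorem prod_iterate_d (k : ℕ) (p : K₁.X × K₂.X) :
    (K₁.prod K₂).d^[k] p = (K₁.d^[k] p.1, K₂.d^[k] p.2) := by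
  simp only [Prod.map_iterate, Prod.map]

theorem prod_iterate_c (k : ℕ) (p : K₁.X × K₂.X) :
    (K₁.prod K₂).c^[k] p = (K₁.c^[k] p.1, K₂.c^[k] p.2) := by
  simp only [Prod.map_iterate, Prod.map]

theorem prod_iterate_e (k : ℕ) (p : K₁.X × K₂.X) :
    (K₁.prod K₂).e^[k] p = (K₁.e^[k] p.1, K₂.e^[k] p.2) := by
  simp only [Prod.map_iterate, Prod.map]

theorem prod_isComp {n k : ℕ} {p q r : K₁.X × K₂.X} :
    (K₁.prod K₂).IsComp n k p q r ↔
      K₁.IsComp n k p.1 q.1 r.1 ∧ K₂.IsComp n k p.2 q.2 r.2 := by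
  unfold IsComp
  rw [prod_iterate_d, prod_iterate_c, Prod.mk.injEq]
  simp only [Set.mem_ofPred_eq]
  tauto

theorem IsStrict.prod (h₁ : K₁.IsStrict) (h₂ : K₂.IsStrict) : (K₁.prod K₂).IsStrict where
  deg_unique m n x hm hn := h₁.deg_unique m n x.1 hm.1 hn.1
  d_mem n x hx := ⟨h₁.d_mem _ _ hx.1, h₂.d_mem _ _ hx.2⟩
  c_mem n x hx := ⟨h₁.c_mem _ _ hx.1, h₂.c_mem _ _ hx.2⟩
  e_mem n x hx := ⟨h₁.e_mem _ _ hx.1, h₂.e_mem _ _ hx.2⟩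
  d_c n x hx := Prod.ext (h₁.d_c _ _ hx.1) (h₂.d_c _ _ hx.2)
  c_d n x hx := Prod.ext (h₁.c_d _ _ hx.1) (h₂.c_d _ _ hx.2)
  d_e n x hx := Prod.ext (h₁.d_e _ _ hx.1) (h₂.d_e _ _ hx.2)
  c_e n x hx := Prod.ext (h₁.c_e _ _ hx.1) (h₂.c_e _ _ hx.2)
  comp_exists n k f g hf hg hk hn h := by
    rw [prod_iterate_d, prod_iterate_c, Prod.mk.injEq] at h
    obtain ⟨r, hr⟩ := h₁.comp_exists n k _ _ hf.1 hg.1 hk hn h.1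
    obtain ⟨s, hs⟩ := h₂.comp_exists n k _ _ hf.2 hg.2 hk hn h.2
    exact ⟨(r, s), prod_isComp.2 ⟨hr, hs⟩⟩
  comp_unique n k f g h h' H H' :=
    Prod.ext (h₁.comp_unique _ _ _ _ _ _ (prod_isComp.1 H).1 (prod_isComp.1 H').1)
      (h₂.comp_unique _ _ _ _ _ _ (prod_isComp.1 H).2 (prod_isComp.1 H').2)
  d_comp_one n f g h H := Prod.ext (h₁.d_comp_one _ _ _ _ (prod_isComp.1 H).1)
    (h₂.d_comp_one _ _ _ _ (prod_isComp.1 H).2)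
  c_comp_one n f g h H := Prod.ext (h₁.c_comp_one _ _ _ _ (prod_isComp.1 H).1)
    (h₂.c_comp_one _ _ _ _ (prod_isComp.1 H).2)
  d_comp n k f g h hk H := prod_isComp.2 ⟨h₁.d_comp _ _ _ _ _ hk (prod_isComp.1 H).1,
    h₂.d_comp _ _ _ _ _ hk (prod_isComp.1 H).2⟩
  c_comp n k f g h hk H := prod_isComp.2 ⟨h₁.c_comp _ _ _ _ _ hk (prod_isComp.1 H).1,
    h₂.c_comp _ _ _ _ _ hk (prod_isComp.1 H).2⟩
  e_comp n k f g h H := prod_isComp.2 ⟨h₁.e_comp _ _ _ _ _ (prod_isComp.1 H).1,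
    h₂.e_comp _ _ _ _ _ (prod_isComp.1 H).2⟩
  comp_unit n k f hf hk hn := by
    rw [prod_iterate_d, prod_iterate_e]
    exact prod_isComp.2 ⟨h₁.comp_unit _ _ _ hf.1 hk hn, h₂.comp_unit _ _ _ hf.2 hk hn⟩
  unit_comp n k f hf hk hn := by
    rw [prod_iterate_c, prod_iterate_e]
    exact prod_isComp.2 ⟨h₁.unit_comp _ _ _ hf.1 hk hn, h₂.unit_comp _ _ _ hf.2 hk hn⟩
  assoc n k f g h p q r H₁ H₂ H₃ := prod_isComp.2
    ⟨h₁.assoc _ _ _ _ _ _ _ _ (prod_isComp.1 H₁).1 (prod_isComp.1 H₂).1 (prod_isComp.1 H₃).1,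
      h₂.assoc _ _ _ _ _ _ _ _ (prod_isComp.1 H₁).2 (prod_isComp.1 H₂).2 (prod_isComp.1 H₃).2⟩
  interchange n j k f f' g g' p q r s t hjk H₁ H₂ H₃ H₄ H₅ := prod_isComp.2
    ⟨h₁.interchange _ _ _ _ _ _ _ _ _ _ _ _ hjk (prod_isComp.1 H₁).1 (prod_isComp.1 H₂).1
        (prod_isComp.1 H₃).1 (prod_isComp.1 H₄).1 (prod_isComp.1 H₅).1,
      h₂.interchange _ _ _ _ _ _ _ _ _ _ _ _ hjk (prod_isComp.1 H₁).2 (prod_isComp.1 H₂).2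
        (prod_isComp.1 H₃).2 (prod_isComp.1 H₄).2 (prod_isComp.1 H₅).2⟩

end InftyData

/-- The iterated functor `(x, (y, z)) ↦ B'(B(x, y), z)`, as a functor of the two variables `x` and
`(y, z)`. -/
def iterB {X₁ X₂ X₃ X₄ X₅ : Type u} (B : ℕ → X₁ → X₂ → X₃) (B' : ℕ → X₃ → X₄ → X₅) :
    ℕ → X₁ → X₂ × X₄ → X₅ :=
  fun n x p => B' n (B n x p.1) p.2

/-- Sections of two functors of two variables agree if their values at the elements and at their
extremal faces do. -/
theorem sectionCell_congr {K₁ K₂ K₂' K₃ : InftyData.{u}} (h₁ : K₁.IsStrict)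
    {B : ℕ → K₁.X → K₂.X → K₃.X} {B' : ℕ → K₁.X → K₂'.X → K₃.X} {n : ℕ} {f : K₂.X} {f' : K₂'.X}
    (h : ∀ g ∈ K₁.cell n, B n g f = B' n g f')
    (hd : ∀ k, ∀ g ∈ K₁.cell k, B k g (K₂.e^[k] (K₂.d^[n] f)) = B' k g (K₂'.e^[k] (K₂'.d^[n] f')))
    (hc : ∀ k, ∀ g ∈ K₁.cell k, B k g (K₂.e^[k] (K₂.c^[n] f)) = B' k g (K₂'.e^[k] (K₂'.c^[n] f'))) :
    sectionCell K₁ K₂ K₃ B n f = sectionCell K₁ K₂' K₃ B' n f' := by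
  have hfn : ∀ {x x'}, (∀ k, ∀ g ∈ K₁.cell k, B k g (K₂.e^[k] x) = B' k g (K₂'.e^[k] x')) →
      sectionFn K₁ K₂ K₃ B x = sectionFn K₁ K₂' K₃ B' x' := fun h => by
    funext k g
    exact h k g g.2
  cases n with
  | zero => exact congrArg FunCell.fn (hfn hd)
  | succ n =>
    simp only [sectionCell, hfn hd, hfn hc]
    congr 1
    funext g
    exact h _ (by simpa using h₁.iterate_e_mem (n + 1) g.2)

namespace IsBifunctor

variable {K₁ K₂ K₃ K₄ K₅ : InftyData.{u}} {B : ℕ → K₁.X → K₂.X → K₃.X}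
  {B' : ℕ → K₃.X → K₄.X → K₅.X}

theorem iter (hB : IsBifunctor K₁ K₂ K₃ B) (hB' : IsBifunctor K₃ K₄ K₅ B') :
    IsBifunctor K₁ (K₂.prod K₄) K₅ (iterB B B') where
  strict₁ := hB.strict₁
  strict₂ := hB.strict₂.prod hB'.strict₂
  strict₃ := hB'.strict₃
  mem _ _ _ hx hy := hB'.mem _ _ _ (hB.mem _ _ _ hx hy.1) hy.2
  map_d n _ y hx hy := (hB'.map_d _ _ _ (hB.mem _ _ _ hx hy.1) hy.2).trans
    (congrArg (B' n · (K₄.d y.2)) (hB.map_d _ _ _ hx hy.1))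
  map_c n _ y hx hy := (hB'.map_c _ _ _ (hB.mem _ _ _ hx hy.1) hy.2).trans
    (congrArg (B' n · (K₄.c y.2)) (hB.map_c _ _ _ hx hy.1))
  map_e n _ y hx hy := (hB'.map_e _ _ _ (hB.mem _ _ _ hx hy.1) hy.2).trans
    (congrArg (B' (n + 1) · (K₄.e y.2)) (hB.map_e _ _ _ hx hy.1))
  map_comp _ _ _ _ _ _ _ _ hx hy := hB'.map_comp _ _ _ _ _ _ _ _
    (hB.map_comp _ _ _ _ _ _ _ _ hx (InftyData.prod_isComp.1 hy).1) (InftyData.prod_isComp.1 hy).2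

/-- The composite (for `n = 0`) or horizontal composite of `B'(-, f')` and `B(-, f)` in `∞-CAT` is
`B'(B(-, f), f')`. -/
theorem hcomp_arr (hB : IsBifunctor K₁ K₂ K₃ B) (hB' : IsBifunctor K₃ K₄ K₅ B') {n : ℕ}
    {f : K₂.X} {f' : K₄.X} (hf : f ∈ K₂.cell n) (hf' : f' ∈ K₄.cell n) :
    InftyCAT.IsComp (n + 1) (n + 1) (sectionArr K₃ K₄ K₅ B' n f') (sectionArr K₁ K₂ K₃ B n f)
      (sectionArr K₁ (K₂.prod K₄) K₅ (iterB B B') n (f, f')) := by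
  have hfn : ∀ (y : K₂.X) (z : K₄.X) m (x : K₁.cell m) (w : K₃.cell m),
      w.1 = sectionFn K₁ K₂ K₃ B y m x →
      sectionFn K₁ (K₂.prod K₄) K₅ (iterB B B') (y, z) m x = sectionFn K₃ K₄ K₅ B' z m w := by
    intro y z m x w hw
    simp only [sectionFn, iterB, Prod.map_iterate, Prod.map_apply, hw]
  refine ⟨⟨hB'.arr_mem hf', hB.arr_mem hf, (hB.iter hB').arr_mem ⟨hf, hf'⟩⟩,
    ⟨Nat.le_add_left 1 n, le_rfl⟩, (hB'.dom_arr hf').trans (hB.cod_arr hf).symm, ?_⟩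
  cases n with
  | zero => exact .fn _ _ _ _ _ _ (hfn f f')
  | succ n =>
    unfold sectionArr
    simp only [sectionCell, Prod.map_iterate, Prod.map_apply]
    -- both factors of the composite are values of `B'` at `w = B(eⁿ⁺¹ a, f)`
    refine .horiz n _ _ _ _ _ _ _ _ _ _ _ _ (hfn _ _) (hfn _ _) fun a b w hb hw => ?_
    have hcod := (hB.isNatural_section hf).cod a
    simp only [← hw] at hcod
    rw [← hb] at hcod
    have := hB'.comp_left w.2 hf' (Nat.le_add_left 1 n) le_rfl
    rw [hcod] at this
    simp only [sectionFn, iterB, ← hw]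
    exact this

variable {K₁₂ K₂₃ K : InftyData.{u}} {B₁₂ : ℕ → K₁.X → K₂.X → K₁₂.X}
  {B₂₃ : ℕ → K₂.X → K₃.X → K₂₃.X} {P : ℕ → K₁₂.X → K₃.X → K.X} {Q : ℕ → K₁.X → K₂₃.X → K.X}

/-- If `P(B₁₂(x, y), z) = Q(x, B₂₃(y, z))`, then `P(B₁₂(-, y), z) = Q(-, B₂₃(y, z))`. -/
theorem section_assoc (h₁₂ : IsBifunctor K₁ K₂ K₁₂ B₁₂) (h₂₃ : IsBifunctor K₂ K₃ K₂₃ B₂₃)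
    (h : ∀ n, ∀ x ∈ K₁.cell n, ∀ y ∈ K₂.cell n, ∀ z ∈ K₃.cell n,
      P n (B₁₂ n x y) z = Q n x (B₂₃ n y z)) {n : ℕ} {y : K₂.X} {z : K₃.X}
    (hy : y ∈ K₂.cell n) (hz : z ∈ K₃.cell n) :
    sectionArr K₁ (K₂.prod K₃) K (iterB B₁₂ P) n (y, z) =
      sectionArr K₁ K₂₃ K Q n (B₂₃ n y z) := by
  have hy0 : y ∈ K₂.cell (0 + n) := by rwa [Nat.zero_add]
  have hz0 : z ∈ K₃.cell (0 + n) := by rwa [Nat.zero_add]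
  have hd := h₂₃.iterate_d hy0 hz0
  have hc := h₂₃.iterate_c hy0 hz0
  rw [Nat.zero_add] at hd hc
  have key : ∀ y ∈ K₂.cell 0, ∀ z ∈ K₃.cell 0, ∀ k, ∀ g ∈ K₁.cell k,
      iterB B₁₂ P k g ((K₂.prod K₃).e^[k] (y, z)) = Q k g (K₂₃.e^[k] (B₂₃ 0 y z)) := by
    intro y hy z hz k g hg
    have hy' := h₂₃.strict₁.iterate_e_mem k hy
    have hz' := h₂₃.strict₂.iterate_e_mem k hz
    rw [InftyData.prod_iterate_e, h₂₃.iterate_e k hy hz]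
    simp only [Nat.zero_add] at hy' hz' ⊢
    exact h k _ hg _ hy' _ hz'
  refine congrArg _ (sectionCell_congr h₁₂.strict₁ (fun g hg => h n g hg y hy z hz) ?_ ?_)
  · rw [hd, InftyData.prod_iterate_d]
    exact key _ (h₂₃.strict₁.iterate_d_mem hy0) _ (h₂₃.strict₂.iterate_d_mem hz0)
  · rw [hc, InftyData.prod_iterate_c]
    exact key _ (h₂₃.strict₁.iterate_c_mem hy0) _ (h₂₃.strict₂.iterate_c_mem hz0)

/-- If `P(B₁₂(x, y), z) = Q(x, B₂₃(y, z))`, then `P(B₁₂(x, -), z) = Q(x, B₂₃(-, z))`. -/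
theorem section_comm (h₁₂ : IsBifunctor K₁ K₂ K₁₂ B₁₂) (h₂₃ : IsBifunctor K₂ K₃ K₂₃ B₂₃)
    (h : ∀ n, ∀ x ∈ K₁.cell n, ∀ y ∈ K₂.cell n, ∀ z ∈ K₃.cell n,
      P n (B₁₂ n x y) z = Q n x (B₂₃ n y z)) {n : ℕ} {x : K₁.X} {z : K₃.X}
    (hx : x ∈ K₁.cell n) (hz : z ∈ K₃.cell n) :
    sectionArr K₂ (K₁.prod K₃) K (iterB (fun n y x => B₁₂ n x y) P) n (x, z) =
      sectionArr K₂ (K₃.prod K₁) K (iterB B₂₃ fun n y x => Q n x y) n (z, x) := by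
  have hx0 : x ∈ K₁.cell (0 + n) := by rwa [Nat.zero_add]
  have hz0 : z ∈ K₃.cell (0 + n) := by rwa [Nat.zero_add]
  have key : ∀ x ∈ K₁.cell 0, ∀ z ∈ K₃.cell 0, ∀ k, ∀ g ∈ K₂.cell k,
      iterB (fun n y x => B₁₂ n x y) P k g ((K₁.prod K₃).e^[k] (x, z)) =
        iterB B₂₃ (fun n y x => Q n x y) k g ((K₃.prod K₁).e^[k] (z, x)) := by
    intro x hx z hz k g hg
    have hx' := h₁₂.strict₁.iterate_e_mem k hx
    have hz' := h₂₃.strict₂.iterate_e_mem k hz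
    rw [InftyData.prod_iterate_e, InftyData.prod_iterate_e]
    rw [Nat.zero_add] at hx' hz'
    exact h k _ hx' _ hg _ hz'
  refine congrArg _ (sectionCell_congr h₁₂.strict₂ (fun g hg => h n x hx g hg z hz) ?_ ?_)
  · rw [InftyData.prod_iterate_d, InftyData.prod_iterate_d]
    exact key _ (h₁₂.strict₁.iterate_d_mem hx0) _ (h₂₃.strict₂.iterate_d_mem hz0)
  · rw [InftyData.prod_iterate_c, InftyData.prod_iterate_c]
    exact key _ (h₁₂.strict₁.iterate_c_mem hx0) _ (h₂₃.strict₂.iterate_c_mem hz0)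

/-- If `P(B₁₂(x, y), z) = Q(x, B₂₃(y, z))`, then the composite of `P(-, z)` and `B₁₂(-, y)` in
`∞-CAT` is `Q(-, B₂₃(y, z))`. -/
theorem hcomp_assoc (h₁₂ : IsBifunctor K₁ K₂ K₁₂ B₁₂) (hP : IsBifunctor K₁₂ K₃ K P)
    (h₂₃ : IsBifunctor K₂ K₃ K₂₃ B₂₃)
    (h : ∀ n, ∀ x ∈ K₁.cell n, ∀ y ∈ K₂.cell n, ∀ z ∈ K₃.cell n,
      P n (B₁₂ n x y) z = Q n x (B₂₃ n y z)) {n : ℕ} {y : K₂.X} {z : K₃.X}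
    (hy : y ∈ K₂.cell n) (hz : z ∈ K₃.cell n) :
    InftyCAT.IsComp (n + 1) (n + 1) (sectionArr K₁₂ K₃ K P n z) (sectionArr K₁ K₂ K₁₂ B₁₂ n y)
      (sectionArr K₁ K₂₃ K Q n (B₂₃ n y z)) :=
  section_assoc (K := K) h₁₂ h₂₃ h hy hz ▸ h₁₂.hcomp_arr hP hy hz

/-- If `P(B₁₂(x, y), z) = Q(x, B₂₃(y, z))`, then `Q(x, -) ∘ B₂₃(-, z) = P(-, z) ∘ B₁₂(x, -)` in
`∞-CAT`. -/
theorem hcomp_comm (h₁₂ : IsBifunctor K₁ K₂ K₁₂ B₁₂) (h₂₃ : IsBifunctor K₂ K₃ K₂₃ B₂₃)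
    (hP : IsBifunctor K₁₂ K₃ K P) (hQ : IsBifunctor K₁ K₂₃ K Q)
    (h : ∀ n, ∀ x ∈ K₁.cell n, ∀ y ∈ K₂.cell n, ∀ z ∈ K₃.cell n,
      P n (B₁₂ n x y) z = Q n x (B₂₃ n y z)) {n : ℕ} {x : K₁.X} {z : K₃.X}
    (hx : x ∈ K₁.cell n) (hz : z ∈ K₃.cell n) :
    ∃ p, InftyCAT.IsComp (n + 1) (n + 1) (sectionArr K₂₃ K₁ K (fun n y x => Q n x y) n x)
        (sectionArr K₂ K₃ K₂₃ B₂₃ n z) p ∧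
      InftyCAT.IsComp (n + 1) (n + 1) (sectionArr K₁₂ K₃ K P n z)
        (sectionArr K₂ K₁ K₁₂ (fun n y x => B₁₂ n x y) n x) p :=
  ⟨_, h₂₃.hcomp_arr hQ.flip hz hx,
    section_comm (K := K) h₁₂ h₂₃ h hx hz ▸ h₁₂.flip.hcomp_arr hP hx hz⟩

end IsBifunctor

/-! ### Composition as a functor of two variables -/

namespace InftyData

/-- The composition `g * f` of `g ∈ Lⁿ(b, c)` and `f ∈ Lⁿ(a, b)`, which are elements of `Lⁿ⁺¹`. -/
noncomputable def star (L : InftyData.{u}) (n : ℕ) (g f : L.X) : L.X :=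
  L.circ (n + 1) (n + 1) g f

variable {L : InftyData.{u}}

theorem preCell_eq (a a' b f : L.X) (n : ℕ) : L.preCell a a' b n f =
    sectionCell (L.Hom a' b) (L.Hom a a') (L.Hom a b) L.star n f := by
  cases n <;> rfl

theorem postCell_eq (a b b' f : L.X) (n : ℕ) : L.postCell a b b' n f =
    sectionCell (L.Hom a b) (L.Hom b b') (L.Hom a b') (fun n g f => L.star n f g) n f := by
  cases n <;> rfl

/-- `L(f, b)` as an element of `∞-CAT`, for `f ∈ Lⁿ(a, a')`. -/
noncomputable abbrev preArr (L : InftyData.{u}) (a a' b : L.X) (n : ℕ) (f : L.X) : CatCell.{u} :=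
  sectionArr (L.Hom a' b) (L.Hom a a') (L.Hom a b) L.star n f

/-- `L(a, f)` as an element of `∞-CAT`, for `f ∈ Lⁿ(b, b')`. -/
noncomputable abbrev postArr (L : InftyData.{u}) (a b b' : L.X) (n : ℕ) (f : L.X) : CatCell.{u} :=
  sectionArr (L.Hom a b) (L.Hom b b') (L.Hom a b') (fun n g f => L.star n f g) n f

theorem arr_preCell (a a' b f : L.X) (n : ℕ) :
    CatCell.arr (L.Hom a' b) (L.Hom a b) (L.preCell a a' b n f) = L.preArr a a' b n f := by
  rw [preCell_eq]
  rfl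

theorem arr_postCell (a b b' f : L.X) (n : ℕ) :
    CatCell.arr (L.Hom a b) (L.Hom a b') (L.postCell a b b' n f) = L.postArr a b b' n f := by
  rw [postCell_eq]
  rfl

namespace IsStrict

theorem isComp_star (hL : L.IsStrict) {a b c : L.X} {n : ℕ} {g f : L.X}
    (hg : g ∈ (L.Hom b c).cell n) (hf : f ∈ (L.Hom a b).cell n) :
    L.IsComp (n + 1) (n + 1) g f (L.star n g f) :=
  hL.isComp_circ hg.1 hf.1 (Nat.le_add_left 1 n) le_rfl (hg.2.1.trans hf.2.2.symm)

theorem star_mem (hL : L.IsStrict) {a b c : L.X} {n : ℕ} {g f : L.X}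
    (hg : g ∈ (L.Hom b c).cell n) (hf : f ∈ (L.Hom a b).cell n) :
    L.star n g f ∈ (L.Hom a c).cell n := by
  have H := hL.isComp_star hg hf
  exact ⟨H.1.2.2, (hL.faces_comp H).1.trans hf.2.1, (hL.faces_comp H).2.trans hg.2.2⟩

/-- Composition is a strict functor of two variables `L(b, c) × L(a, b) → L(a, c)`; this is where
the interchange law enters. -/
theorem isBifunctor_star (hL : L.IsStrict) (a b c : L.X) :
    IsBifunctor (L.Hom b c) (L.Hom a b) (L.Hom a c) L.star where
  strict₁ := hL.hom b c
  strict₂ := hL.hom a b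
  strict₃ := hL.hom a c
  mem n x y hx hy := hL.star_mem hx hy
  map_d n x y hx hy := (hL.circ_eq
    (hL.d_comp _ _ _ _ _ (Nat.le_add_left 1 n) (hL.isComp_star hx hy))).symm
  map_c n x y hx hy := (hL.circ_eq
    (hL.c_comp _ _ _ _ _ (Nat.le_add_left 1 n) (hL.isComp_star hx hy))).symm
  map_e n x y hx hy := (hL.circ_eq (hL.e_comp _ _ _ _ _ (hL.isComp_star hx hy))).symm
  map_comp n k x x' x'' y y' y'' hx hy := by
    refine hL.isComp_hom ?_ hx.2.1.2 (hL.star_mem hx.1.1 hy.1.1)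
    exact hL.interchange _ _ _ _ _ _ _ _ _ _ _ _ (Nat.lt_succ_of_le hx.2.1.2) hx.to_hom hy.to_hom
      (hL.isComp_star hx.1.2.2 hy.1.2.2) (hL.isComp_star hx.1.1 hy.1.1)
      (hL.isComp_star hx.1.2.1 hy.1.2.1)

theorem isBifunctor_star_flip (hL : L.IsStrict) (a b c : L.X) :
    IsBifunctor (L.Hom a b) (L.Hom b c) (L.Hom a c) fun n f g => L.star n g f :=
  (hL.isBifunctor_star a b c).flip

theorem star_assoc (hL : L.IsStrict) {a b c d : L.X} {n : ℕ} {h g f : L.X}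
    (hh : h ∈ (L.Hom c d).cell n) (hg : g ∈ (L.Hom b c).cell n) (hf : f ∈ (L.Hom a b).cell n) :
    L.star n (L.star n h g) f = L.star n h (L.star n g f) :=
  (hL.circ_eq (hL.assoc _ _ _ _ _ _ _ _ (hL.isComp_star hh hg)
    (hL.isComp_star (hL.star_mem hh hg) hf) (hL.isComp_star hg hf))).symm

theorem e_mem_hom (hL : L.IsStrict) {a : L.X} (ha : a ∈ L.cell 0) : L.e a ∈ (L.Hom a a).cell 0 :=
  ⟨hL.e_mem _ _ ha, hL.d_e _ _ ha, hL.c_e _ _ ha⟩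

theorem star_e (hL : L.IsStrict) {a b : L.X} {n : ℕ} {f : L.X} (hf : f ∈ (L.Hom a b).cell n) :
    L.star n f (L.e^[n] (L.e a)) = f := by
  have := hL.comp_unit (n + 1) (n + 1) f hf.1 (Nat.le_add_left 1 n) le_rfl
  rw [hf.2.1, Function.iterate_succ_apply] at this
  exact hL.circ_eq this

theorem e_star (hL : L.IsStrict) {a b : L.X} {n : ℕ} {f : L.X} (hf : f ∈ (L.Hom a b).cell n) :
    L.star n (L.e^[n] (L.e b)) f = f := by
  have := hL.unit_comp (n + 1) (n + 1) f hf.1 (Nat.le_add_left 1 n) le_rfl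
  rw [hf.2.2, Function.iterate_succ_apply] at this
  exact hL.circ_eq this

/-- `L(a, g) ∘ L(a, f) = L(a, g * f)`. -/
theorem comp_postArr (hL : L.IsStrict) (x : L.X) {a b c : L.X} {n : ℕ} {g f : L.X}
    (hg : g ∈ (L.Hom b c).cell n) (hf : f ∈ (L.Hom a b).cell n) :
    InftyCAT.IsComp (n + 1) (n + 1) (L.postArr x b c n g) (L.postArr x a b n f)
      (L.postArr x a c n (L.star n g f)) := by
  exact IsBifunctor.hcomp_assoc (hL.isBifunctor_star_flip x a b) (hL.isBifunctor_star_flip x b c)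
    (hL.isBifunctor_star_flip a b c) (fun n x hx y hy z hz => (hL.star_assoc hz hy hx).symm) hf hg

/-- `L(f, b) ∘ L(g, b) = L(g * f, b)`. -/
theorem comp_preArr (hL : L.IsStrict) (x : L.X) {a b c : L.X} {n : ℕ} {g f : L.X}
    (hg : g ∈ (L.Hom b c).cell n) (hf : f ∈ (L.Hom a b).cell n) :
    InftyCAT.IsComp (n + 1) (n + 1) (L.preArr a b x n f) (L.preArr b c x n g)
      (L.preArr a c x n (L.star n g f)) := by
  exact IsBifunctor.hcomp_assoc (hL.isBifunctor_star b c x) (hL.isBifunctor_star a b x)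
    (hL.isBifunctor_star a b c) (fun n x hx y hy z hz => hL.star_assoc hx hy hz) hg hf

/-- `L(x, f) ∘ L(h, a) = L(h, b) ∘ L(y, f)` for `h ∈ Lⁿ(x, y)` and `f ∈ Lⁿ(a, b)`. -/
theorem comp_postArr_preArr (hL : L.IsStrict) {x y a b : L.X} {n : ℕ} {h f : L.X}
    (hh : h ∈ (L.Hom x y).cell n) (hf : f ∈ (L.Hom a b).cell n) :
    ∃ p, InftyCAT.IsComp (n + 1) (n + 1) (L.postArr x a b n f) (L.preArr x y a n h) p ∧
      InftyCAT.IsComp (n + 1) (n + 1) (L.preArr x y b n h) (L.postArr y a b n f) p := by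
  exact IsBifunctor.hcomp_comm (hL.isBifunctor_star y a b) (hL.isBifunctor_star x y a)
    (hL.isBifunctor_star x y b) (hL.isBifunctor_star x a b)
    (fun n x hx y hy z hz => hL.star_assoc hx hy hz) hf hh

/-! ### The opposite category -/

theorem op_d_one {x : L.X} (hx : x ∈ L.cell 1) : L.Op.d x = L.c x := if_pos hx

theorem op_c_one {x : L.X} (hx : x ∈ L.cell 1) : L.Op.c x = L.d x := if_pos hx

theorem op_d (hL : L.IsStrict) {n : ℕ} {x : L.X} (hx : x ∈ L.cell (n + 2)) : L.Op.d x = L.d x :=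
  if_neg fun h => by simpa using hL.deg_unique _ _ _ hx h

theorem op_c (hL : L.IsStrict) {n : ℕ} {x : L.X} (hx : x ∈ L.cell (n + 2)) : L.Op.c x = L.c x :=
  if_neg fun h => by simpa using hL.deg_unique _ _ _ hx h

theorem op_iterate_d (hL : L.IsStrict) {n k : ℕ} {x : L.X} (hx : x ∈ L.cell n) (hk : k < n) :
    L.Op.d^[k] x = L.d^[k] x := by
  induction k generalizing x n with
  | zero => rfl
  | succ k ih =>
    obtain ⟨n, rfl⟩ := Nat.exists_eq_add_of_le' (show 2 ≤ n by omega)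
    rw [Function.iterate_succ_apply, Function.iterate_succ_apply, hL.op_d hx]
    exact ih (hL.d_mem _ _ hx) (by omega)

theorem op_iterate_c (hL : L.IsStrict) {n k : ℕ} {x : L.X} (hx : x ∈ L.cell n) (hk : k < n) :
    L.Op.c^[k] x = L.c^[k] x := by
  induction k generalizing x n with
  | zero => rfl
  | succ k ih =>
    obtain ⟨n, rfl⟩ := Nat.exists_eq_add_of_le' (show 2 ≤ n by omega)
    rw [Function.iterate_succ_apply, Function.iterate_succ_apply, hL.op_c hx]
    exact ih (hL.c_mem _ _ hx) (by omega)

theorem op_dom (hL : L.IsStrict) {n : ℕ} {x : L.X} (hx : x ∈ L.cell (n + 1)) :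
    L.Op.d^[n + 1] x = L.c^[n + 1] x := by
  have hx' : x ∈ L.cell (0 + 1 + n) := by rwa [Nat.zero_add, Nat.add_comm]
  rw [Function.iterate_succ_apply', hL.op_iterate_d hx (Nat.lt_succ_self n),
    op_d_one (hL.iterate_d_mem hx'), hL.c_iterate_d hx']

theorem op_cod (hL : L.IsStrict) {n : ℕ} {x : L.X} (hx : x ∈ L.cell (n + 1)) :
    L.Op.c^[n + 1] x = L.d^[n + 1] x := by
  have hx' : x ∈ L.cell (0 + 1 + n) := by rwa [Nat.zero_add, Nat.add_comm]
  rw [Function.iterate_succ_apply', hL.op_iterate_c hx (Nat.lt_succ_self n),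
    op_c_one (hL.iterate_c_mem hx'), hL.d_iterate_c hx']

theorem isComp_of_op (hL : L.IsStrict) {n k : ℕ} {f g h : L.X} (H : L.Op.IsComp n k f g h)
    (hk : k < n) : L.IsComp n k f g h := by
  obtain ⟨hm, hkn, hdc, hc⟩ := H
  rw [hL.op_iterate_d hm.1 hk, hL.op_iterate_c hm.2.1 hk] at hdc
  exact ⟨hm, hkn, hdc, (if_neg fun h => hk.ne (hL.deg_unique _ _ _ h hm.1)).mp hc⟩

theorem isComp_of_op_self (hL : L.IsStrict) {n : ℕ} {f g h : L.X}
    (H : L.Op.IsComp (n + 1) (n + 1) f g h) : L.IsComp (n + 1) (n + 1) g f h := by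
  obtain ⟨hm, hkn, hdc, hc⟩ := H
  rw [hL.op_dom hm.1, hL.op_cod hm.2.1] at hdc
  exact ⟨⟨hm.2.1, hm.1, hm.2.2⟩, hkn, hdc.symm, (if_pos hm.1).mp hc⟩

end IsStrict

/-! ### The hom-functors -/

theorem homFunctor_succ {a a' : L.X} (b : L.X) {n : ℕ} (f : L.Op.cell (n + 1))
    (hf : f.1 ∈ (L.Hom a a').cell n) : L.homFunctor b (n + 1) f = L.preArr a a' b n f := by
  obtain ⟨-, rfl, rfl⟩ := hf
  exact arr_preCell _ _ _ _ _

theorem mem_hom_self {n : ℕ} {f : L.X} (hf : f ∈ L.cell (n + 1)) :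
    f ∈ (L.Hom (L.d^[n + 1] f) (L.c^[n + 1] f)).cell n :=
  ⟨hf, rfl, rfl⟩

/-- `≈₁` is reflexive on functors and modifications between strict `∞`-categories. -/
theorem approx_refl {n : ℕ} {x : CatCell.{u}} (hx : x ∈ InftyCAT.cell (n + 1)) :
    CatCell.Approx x x := by
  cases x with
  | obj => exact hx.elim
  | arr K K' x =>
    obtain ⟨-, hK', hx⟩ := hx
    cases x with
    | fn F =>
      cases n with
      | zero => exact .fn _ _ _ _ fun m y => hK'.sim_refl (hx.mem m y)
      | succ n => exact hx.elim
    | mod m F G α =>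
      cases n with
      | zero => exact hx.elim
      | succ n =>
        obtain ⟨rfl, -, -, hα⟩ := hx
        have : ∀ a, α a ∈ K'.cell (m + 1) := by
          cases m with
          | zero => exact hα.mem
          | succ m => exact hα.1.mem
        exact .mod _ _ _ _ _ _ _ fun a => hK'.sim_refl (this a)

theorem IsStrict.isFunctor_homFunctor (hL : L.IsStrict) (b : L.X) :
    IsFunctor L.Op InftyCAT.{u} CatCell.Approx (L.homFunctor b) := by
  have hB := fun x y => hL.isBifunctor_star x y b
  have hmem : ∀ n (x : L.Op.cell n), L.homFunctor b n x ∈ InftyCAT.cell n := by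
    rintro (_ | n) x
    · exact hL.hom _ _
    · rw [homFunctor_succ b x (mem_hom_self x.2)]
      exact (hB _ _).arr_mem (mem_hom_self x.2)
  refine ⟨hmem, ?_, ?_, ?_, ?_⟩
  · rintro (_ | n) x y hy
    · rw [IsStrict.op_d_one (L := L) x.2] at hy
      exact congrArg (fun a => CatCell.obj (L.Hom a b)) hy
    · rw [hL.op_d x.2] at hy
      rw [homFunctor_succ b x (mem_hom_self x.2)]
      refine Eq.trans ?_ ((hB _ _).d_arr (mem_hom_self x.2)).symm
      rw [homFunctor_succ b y (by rw [hy]; exact hL.hom_d_mem (mem_hom_self x.2)), hy]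
  · rintro (_ | n) x y hy
    · rw [IsStrict.op_c_one (L := L) x.2] at hy
      exact congrArg (fun a => CatCell.obj (L.Hom a b)) hy
    · rw [hL.op_c x.2] at hy
      rw [homFunctor_succ b x (mem_hom_self x.2)]
      refine Eq.trans ?_ ((hB _ _).c_arr (mem_hom_self x.2)).symm
      rw [homFunctor_succ b y (by rw [hy]; exact hL.hom_c_mem (mem_hom_self x.2)), hy]
  · rintro n x y hy
    have : L.homFunctor b (n + 1) y = InftyCAT.e (L.homFunctor b n x) := by
      cases n with
      | zero =>
        rw [homFunctor_succ b y (by rw [hy]; exact hL.e_mem_hom x.2)]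
        refine congrArg (CatCell.arr (L.Hom x b) (L.Hom x b)) (congrArg FunCell.fn ?_)
        funext k g
        simp only [sectionFn, hy]
        exact hL.star_e g.2
      | succ n =>
        rw [homFunctor_succ b x (mem_hom_self x.2),
          homFunctor_succ b y (by rw [hy]; exact (hL.hom _ _).e_mem _ _ (mem_hom_self x.2)), hy]
        exact ((hB _ _).e_arr (mem_hom_self x.2)).symm
    rw [← this]
    exact approx_refl (hmem _ y)
  · rintro n k x y z H
    obtain ⟨n, rfl⟩ := Nat.exists_eq_add_of_le' (H.2.1.1.trans H.2.1.2)
    refine ⟨_, ?_, approx_refl (hmem _ z)⟩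
    rcases H.2.1.2.lt_or_eq with hk | rfl
    · -- below the top dimension the composite is taken in a hom-set, and is preserved componentwise
      have H' := hL.isComp_hom (hL.isComp_of_op H hk) (Nat.le_of_lt_succ hk) (mem_hom_self x.2)
      rw [homFunctor_succ b x H'.1.1, homFunctor_succ b y H'.1.2.1, homFunctor_succ b z H'.1.2.2]
      exact (hB _ _).comp_arr H'
    · have H' := hL.isComp_of_op_self H
      have hy : y.1 ∈ (L.Hom (L.c^[n + 1] x.1) (L.c^[n + 1] y.1)).cell n := ⟨y.2, H'.2.2.1, rfl⟩
      have hz : L.star n y x = z := hL.circ_eq H'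
      have := hL.comp_preArr b hy (mem_hom_self x.2)
      rw [homFunctor_succ b x (mem_hom_self x.2), homFunctor_succ b y hy, homFunctor_succ b z
        (hz ▸ hL.star_mem hy (mem_hom_self x.2)), ← hz]
      exact this

end InftyData

/-! ### The Yoneda map -/

namespace InftyData

variable {L : InftyData.{u}}

/-- The element `L(-, f)` of `∞-CAT^{Lᵒᵖ}` for `f ∈ Lⁿ(a, b)`, with explicit end points `a` and
`b`. -/
noncomputable def yonedaCell (L : InftyData.{u}) (a b : L.X) (n : ℕ) (f : L.X) :
    FunCell L.Op InftyCAT.{u} :=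
  .mod n (L.homFunctor a) (L.homFunctor b) (fun x => L.postArr x.1 a b n f)

theorem yoneda_succ {a b : L.X} {n : ℕ} (f : L.cell (n + 1)) (hf : f.1 ∈ (L.Hom a b).cell n) :
    L.yoneda (n + 1) f = L.yonedaCell a b n f := by
  obtain ⟨-, rfl, rfl⟩ := hf
  exact congrArg (FunCell.mod n _ _) (funext fun x => arr_postCell _ _ _ _ _)

namespace IsStrict

theorem isNatural_yonedaCell (hL : L.IsStrict) {a b : L.X} {n : ℕ} {f : L.X}
    (hf : f ∈ (L.Hom a b).cell n) :
    IsNatural L.Op InftyCAT.{u} CatCell.Approx (L.homFunctor a) (L.homFunctor b) n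
      (fun x => L.postArr x.1 a b n f) := by
  have hB := fun x => hL.isBifunctor_star_flip x a b
  refine ⟨fun x => (hB x).arr_mem hf, fun x => (hB x).dom_arr hf, fun x => (hB x).cod_arr hf,
    fun k x y h hx hy => ?_⟩
  have hk : L.e^[k] f ∈ (L.Hom a b).cell (k + n) := by
    rw [Nat.add_comm]
    exact (hL.hom a b).iterate_e_mem k hf
  have hh : h.1 ∈ (L.Hom y x).cell (k + n) :=
    ⟨h.2, (hL.op_cod h.2).symm.trans hy, (hL.op_dom h.2).symm.trans hx⟩
  obtain ⟨p, hp, hq⟩ := hL.comp_postArr_preArr hh hk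
  have he : ∀ z, InftyCAT.e^[k] (L.postArr z a b n f) = L.postArr z a b (k + n) (L.e^[k] f) :=
    fun z => by
      rw [Nat.add_comm k n]
      exact (hB z).iterate_e_arr k hf
  refine ⟨p, p, ?_, ?_, approx_refl hp.1.2.2⟩
  · rw [homFunctor_succ a h hh, he]
    exact hp
  · rw [homFunctor_succ b h hh, he]
    exact hq

theorem isModification_yonedaCell (hL : L.IsStrict) {a b : L.X} {n : ℕ} {f : L.X}
    (hf : f ∈ (L.Hom a b).cell n) :
    IsModification L.Op InftyCAT.{u} CatCell.Approx (L.homFunctor a) (L.homFunctor b) n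
      (fun x => L.postArr x.1 a b n f) := by
  have hB := fun x => hL.isBifunctor_star_flip x a b
  induction n generalizing f with
  | zero => exact hL.isNatural_yonedaCell hf
  | succ n ih =>
    refine ⟨hL.isNatural_yonedaCell hf, ?_, ?_⟩
    · have := ih (hL.hom_d_mem hf)
      rwa [show (fun x : L.Op.cell 0 => L.postArr x.1 a b n (L.d f)) = _ from
        funext fun x => ((hB x).d_arr hf).symm] at this
    · have := ih (hL.hom_c_mem hf)
      rwa [show (fun x : L.Op.cell 0 => L.postArr x.1 a b n (L.c f)) = _ from
        funext fun x => ((hB x).c_arr hf).symm] at this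

theorem yonedaCell_mem (hL : L.IsStrict) {a b : L.X} {n : ℕ} {f : L.X}
    (hf : f ∈ (L.Hom a b).cell n) : L.yonedaCell a b n f ∈ L.Presheaf.cell (n + 1) :=
  ⟨rfl, hL.isFunctor_homFunctor a, hL.isFunctor_homFunctor b, hL.isModification_yonedaCell hf⟩

theorem d_yonedaCell (hL : L.IsStrict) {a b : L.X} {n : ℕ} {f : L.X}
    (hf : f ∈ (L.Hom a b).cell (n + 1)) :
    L.Presheaf.d (L.yonedaCell a b (n + 1) f) = L.yonedaCell a b n (L.d f) :=
  congrArg (FunCell.mod n _ _) (funext fun x => (hL.isBifunctor_star_flip x a b).d_arr hf)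

theorem c_yonedaCell (hL : L.IsStrict) {a b : L.X} {n : ℕ} {f : L.X}
    (hf : f ∈ (L.Hom a b).cell (n + 1)) :
    L.Presheaf.c (L.yonedaCell a b (n + 1) f) = L.yonedaCell a b n (L.c f) :=
  congrArg (FunCell.mod n _ _) (funext fun x => (hL.isBifunctor_star_flip x a b).c_arr hf)

theorem e_yonedaCell (hL : L.IsStrict) {a b : L.X} {n : ℕ} {f : L.X}
    (hf : f ∈ (L.Hom a b).cell n) :
    L.Presheaf.e (L.yonedaCell a b n f) = L.yonedaCell a b (n + 1) (L.e f) :=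
  congrArg (FunCell.mod (n + 1) _ _) (funext fun x => (hL.isBifunctor_star_flip x a b).e_arr hf)

end IsStrict

end InftyData

theorem GMap.iterate_d {L : InftyData.{u}} {K : InftyData.{v}} {F : GMap L K} (hL : L.IsStrict)
    (h : ∀ n (x : L.cell (n + 1)) (y : L.cell n), y.1 = L.d x.1 → F n y = K.d (F (n + 1) x))
    {n k : ℕ} (x : L.cell (n + k)) (y : L.cell n) (hy : y.1 = L.d^[k] x.1) :
    F n y = K.d^[k] (F (n + k) x) := by
  induction k with
  | zero => exact congrArg (F n) (Subtype.ext hy)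
  | succ k ih =>
    rw [ih ⟨L.d x.1, hL.d_mem _ _ x.2⟩ hy, Function.iterate_succ_apply]
    exact congrArg K.d^[k] (h (n + k) x _ rfl)

theorem GMap.iterate_c {L : InftyData.{u}} {K : InftyData.{v}} {F : GMap L K} (hL : L.IsStrict)
    (h : ∀ n (x : L.cell (n + 1)) (y : L.cell n), y.1 = L.c x.1 → F n y = K.c (F (n + 1) x))
    {n k : ℕ} (x : L.cell (n + k)) (y : L.cell n) (hy : y.1 = L.c^[k] x.1) :
    F n y = K.c^[k] (F (n + k) x) := by
  induction k with
  | zero => exact congrArg (F n) (Subtype.ext hy)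
  | succ k ih =>
    rw [ih ⟨L.c x.1, hL.c_mem _ _ x.2⟩ hy, Function.iterate_succ_apply]
    exact congrArg K.c^[k] (h (n + k) x _ rfl)

namespace InftyData

variable {L : InftyData.{u}}

theorem IsStrict.isFunctor_yoneda (hL : L.IsStrict) : IsFunctor L L.Presheaf Eq L.yoneda := by
  have hmem : ∀ n (x : L.cell n), L.yoneda n x ∈ L.Presheaf.cell n := by
    rintro (_ | n) x
    · exact hL.isFunctor_homFunctor x
    · rw [yoneda_succ x (mem_hom_self x.2)]
      exact hL.yonedaCell_mem (mem_hom_self x.2)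
  have hd : ∀ n (x : L.cell (n + 1)) (y : L.cell n), y.1 = L.d x.1 →
      L.yoneda n y = L.Presheaf.d (L.yoneda (n + 1) x) := by
    rintro (_ | n) x y hy
    · exact congrArg (fun a => FunCell.fn (L.homFunctor a)) hy
    · rw [yoneda_succ x (mem_hom_self x.2), hL.d_yonedaCell (mem_hom_self x.2),
        yoneda_succ y (by rw [hy]; exact hL.hom_d_mem (mem_hom_self x.2)), hy]
  have hc : ∀ n (x : L.cell (n + 1)) (y : L.cell n), y.1 = L.c x.1 →
      L.yoneda n y = L.Presheaf.c (L.yoneda (n + 1) x) := by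
    rintro (_ | n) x y hy
    · exact congrArg (fun a => FunCell.fn (L.homFunctor a)) hy
    · rw [yoneda_succ x (mem_hom_self x.2), hL.c_yonedaCell (mem_hom_self x.2),
        yoneda_succ y (by rw [hy]; exact hL.hom_c_mem (mem_hom_self x.2)), hy]
  refine ⟨hmem, hd, hc, ?_, ?_⟩
  · rintro (_ | n) x y hy
    · rw [yoneda_succ y (by rw [hy]; exact hL.e_mem_hom x.2)]
      refine congrArg (FunCell.mod 0 _ _) (funext fun z => ?_)
      refine congrArg (CatCell.arr (L.Hom z x) (L.Hom z x)) (congrArg FunCell.fn ?_)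
      funext k g
      simp only [sectionFn, hy]
      exact hL.e_star g.2
    · rw [yoneda_succ x (mem_hom_self x.2), hL.e_yonedaCell (mem_hom_self x.2),
        yoneda_succ y (by rw [hy]; exact (hL.hom _ _).e_mem _ _ (mem_hom_self x.2)), hy]
  · rintro n k x y z H
    refine ⟨_, ⟨⟨hmem _ x, hmem _ y, hmem _ z⟩, H.2.1, ?_, ?_⟩, rfl⟩
    · obtain ⟨m, rfl⟩ := Nat.exists_eq_add_of_le' H.2.1.2
      rw [← GMap.iterate_d hL hd x ⟨_, hL.iterate_d_mem x.2⟩ rfl,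
        ← GMap.iterate_c hL hc y ⟨_, hL.iterate_d_mem x.2⟩ H.2.2.1]
    · obtain ⟨n, rfl⟩ := Nat.exists_eq_add_of_le' (H.2.1.1.trans H.2.1.2)
      rcases H.2.1.2.lt_or_eq with hk | rfl
      · have H' := hL.isComp_hom H (Nat.le_of_lt_succ hk) (mem_hom_self x.2)
        rw [yoneda_succ x H'.1.1, yoneda_succ y H'.1.2.1, yoneda_succ z H'.1.2.2]
        exact .mod _ _ _ _ _ _ _ _ _ fun a => (hL.isBifunctor_star_flip _ _ _).comp_arr H'
      · have hx : x.1 ∈ (L.Hom (L.c^[n + 1] y.1) (L.c^[n + 1] x.1)).cell n := ⟨x.2, H.2.2.1, rfl⟩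
        have hz : L.star n x y = z := hL.circ_eq H
        rw [yoneda_succ x hx, yoneda_succ y (mem_hom_self y.2), yoneda_succ z
          (hz ▸ hL.star_mem hx (mem_hom_self y.2)), ← hz]
        exact .mod _ _ _ _ _ _ _ _ _ fun a => hL.comp_postArr _ hx (mem_hom_self y.2)

/-! ### Injectivity of the Yoneda map -/

theorem IsStrict.homFunctor_injective (hL : L.IsStrict) {a b : L.X} (ha : a ∈ L.cell 0)
    (h : L.homFunctor a = L.homFunctor b) : a = b := by
  have h1 := congrFun (congrFun h 0) ⟨a, ha⟩
  simp only [homFunctor, CatCell.obj.injEq, Hom, mk.injEq, heq_eq_eq, true_and, and_true] at h1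
  have h2 : L.e a ∈ (L.Hom a b).cell 0 :=
    (Set.ext_iff.1 (congrFun h1 0) (L.e a)).1 (hL.e_mem_hom ha)
  exact (hL.e_mem_hom ha).2.2.symm.trans h2.2.2

theorem IsStrict.sectionCell_injective (hL : L.IsStrict) {a b : L.X} (ha : a ∈ L.cell 0) {n : ℕ}
    {f g : L.X} (hf : f ∈ (L.Hom a b).cell n) (hg : g ∈ (L.Hom a b).cell n)
    (h : sectionCell (L.Hom a a) (L.Hom a b) (L.Hom a b) (fun n g f => L.star n f g) n f =
      sectionCell (L.Hom a a) (L.Hom a b) (L.Hom a b) (fun n g f => L.star n f g) n g) :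
    f = g := by
  rw [← hL.star_e hf, ← hL.star_e hg]
  cases n with
  | zero =>
    simp only [sectionCell, FunCell.fn.injEq] at h
    exact congrFun (congrFun h 0) ⟨_, hL.e_mem_hom ha⟩
  | succ n =>
    simp only [sectionCell, FunCell.mod.injEq] at h
    exact congrFun h.2.2.2 ⟨_, hL.e_mem_hom ha⟩

theorem IsStrict.yonedaCell_injective (hL : L.IsStrict) {a b : L.X} (ha : a ∈ L.cell 0) {n : ℕ}
    {f g : L.X} (hf : f ∈ (L.Hom a b).cell n) (hg : g ∈ (L.Hom a b).cell n)
    (h : L.yonedaCell a b n f = L.yonedaCell a b n g) : f = g := by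
  simp only [yonedaCell, FunCell.mod.injEq] at h
  have := congrFun h.2.2.2 ⟨a, ha⟩
  simp only [postArr, sectionArr, CatCell.arr.injEq] at this
  exact hL.sectionCell_injective ha hf hg (eq_of_heq this.2.2)

theorem IsStrict.yoneda_injective (hL : L.IsStrict) (m n : ℕ) (x : L.cell m) (y : L.cell n)
    (h : L.yoneda m x = L.yoneda n y) : x.1 = y.1 := by
  cases m with
  | zero =>
    cases n with
    | zero =>
      simp only [yoneda, FunCell.fn.injEq] at h
      exact hL.homFunctor_injective x.2 h
    | succ n => simp [yoneda] at h
  | succ m =>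
    cases n with
    | zero => simp [yoneda] at h
    | succ n =>
      have h' := h
      simp only [yoneda, FunCell.mod.injEq] at h'
      obtain ⟨rfl, h1, h2, -⟩ := h'
      have hx : x.1 ∈ L.cell (0 + (m + 1)) := by
        rw [Nat.zero_add]
        exact x.2
      have hd := hL.homFunctor_injective (hL.iterate_d_mem hx) h1
      have hc := hL.homFunctor_injective (hL.iterate_c_mem hx) h2
      have hy : y.1 ∈ (L.Hom (L.d^[m + 1] x.1) (L.c^[m + 1] x.1)).cell m :=
        ⟨y.2, hd.symm, hc.symm⟩
      rw [yoneda_succ x (mem_hom_self x.2), yoneda_succ y hy] at h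
      exact hL.yonedaCell_injective (hL.iterate_d_mem hx) (mem_hom_self x.2) hy h

/-! ### Inversion of composites -/

/-- In degree `n + 1`, the composites `∘ₖ` of `∞-CAT` with `k ≤ n` are those of `∞-CAT(A, B)`; only
`∘ₙ₊₁` is a composite of functors or a horizontal composite. -/
theorem funCell_comp_of_comp {A B : InftyData.{u}} {n k : ℕ} {x y z : FunCell A B}
    (hx : FunCell.IsCell B.Sim n x) (hk : k ≤ n)
    (h : CatCell.Comp k (.arr A B x) (.arr A B y) (.arr A B z)) : FunCell.Comp k x y z := by
  cases h with
  | vert n k _ _ _ _ _ h => exact h.2.2.2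
  | fn =>
    cases n with
    | zero => omega
    | succ n => exact hx.elim
  | horiz m =>
    cases n with
    | zero => omega
    | succ n =>
      obtain ⟨rfl, -⟩ := hx
      omega

theorem values_of_comp_fn {A B C : InftyData.{u}} {k : ℕ} {G : GMap B C} {F : GMap A B}
    {P : GMap A C} (h : CatCell.Comp k (.arr B C (.fn G)) (.arr A B (.fn F)) (.arr A C (.fn P))) :
    ∀ m x y, y.1 = F m x → P m x = G m y := by
  cases h with
  | vert n k _ _ _ _ _ h => cases h.2.2.2
  | fn _ _ _ _ _ _ hP => exact hP

theorem components_of_comp_mod {A B C : InftyData.{u}} {n : ℕ} {G H : GMap B C}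
    {α : B.cell 0 → C.X} {F F' : GMap A B} {β : A.cell 0 → B.X} {z : CatCell.{u}}
    (h : CatCell.Comp (n + 2) (.arr B C (.mod n G H α)) (.arr A B (.mod n F F' β)) z) :
    ∃ P Q γ, z = .arr A C (.mod n P Q γ) ∧ ∀ (a : A.cell 0) (b : B.cell 0) (w : B.cell (n + 1)),
      b.1 = F' 0 a → w.1 = β a → C.IsComp (n + 1) (n + 1) (α b) (G (n + 1) w) (γ a) := by
  generalize hk : n + 2 = k at h
  cases h with
  | vert m k _ _ _ _ _ h =>
    obtain ⟨⟨hm, -⟩, ⟨-, hkm⟩, -⟩ := h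
    cases m with
    | zero => omega
    | succ m =>
      obtain ⟨rfl, -⟩ := hm
      omega
  | horiz _ _ _ _ _ _ _ _ _ _ P Q γ _ _ hγ => exact ⟨P, Q, γ, rfl, hγ⟩

theorem sim_of_approx_mod {A B : InftyData.{u}} {n : ℕ} {P Q P' Q' : GMap A B}
    {γ γ' : A.cell 0 → B.X}
    (h : CatCell.Approx (.arr A B (.mod n P Q γ)) (.arr A B (.mod n P' Q' γ'))) (a : A.cell 0) :
    B.Sim (γ a) (γ' a) := by
  cases h with
  | mod _ _ _ _ _ _ _ h => exact h a

/-- The Yoneda map reflects composites in the hom-sets `L(a, b)`. -/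
theorem IsStrict.isComp_of_yonedaCell (hL : L.IsStrict) {a b : L.X} (ha : a ∈ L.cell 0) {n k : ℕ}
    {f g h : L.X} (hf : f ∈ (L.Hom a b).cell n) (hg : g ∈ (L.Hom a b).cell n)
    (hh : h ∈ (L.Hom a b).cell n) (hk : k ≤ n)
    (H : L.Presheaf.IsComp (n + 1) k (L.yonedaCell a b n f) (L.yonedaCell a b n g)
      (L.yonedaCell a b n h)) : (L.Hom a b).IsComp n k f g h := by
  obtain ⟨-, ⟨h1, -⟩, -, H⟩ := H
  obtain ⟨n, rfl⟩ := Nat.exists_eq_add_of_le' (h1.trans hk)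
  unfold yonedaCell at H
  cases H with
  | mod _ _ _ _ _ _ _ _ _ H =>
    have H1 := funCell_comp_of_comp ((hL.isBifunctor_star_flip a a b).section_mem hf) hk
      (H ⟨a, ha⟩).2.2.2
    simp only [sectionCell] at H1
    -- the end points are replaced by variables, to be unified in the case distinction
    generalize sectionFn (L.Hom a a) (L.Hom a b) (L.Hom a b) (fun n g f => L.star n f g) = s at H1
    generalize s (L.d^[n + 1] f) = df, s (L.c^[n + 1] f) = cf, s (L.d^[n + 1] g) = dg,
      s (L.c^[n + 1] g) = cg, s (L.d^[n + 1] h) = dh, s (L.c^[n + 1] h) = ch at H1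
    cases H1 with
    | mod _ _ _ _ _ _ _ _ _ H2 =>
      have := H2 ⟨_, hL.e_mem_hom ha⟩
      simp only [hL.star_e hf, hL.star_e hg, hL.star_e hh] at this
      exact this

/-- The Yoneda map reflects composites of arrows of degree `1`. -/
theorem IsStrict.star_eq_of_yonedaCell (hL : L.IsStrict) {a b c : L.X} (ha : a ∈ L.cell 0)
    {g f h : L.X} (hf : f ∈ (L.Hom a b).cell 0)
    (hh : h ∈ (L.Hom a c).cell 0)
    (H : L.Presheaf.IsComp 1 1 (L.yonedaCell b c 0 g) (L.yonedaCell a b 0 f)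
      (L.yonedaCell a c 0 h)) : L.star 0 g f = h := by
  have H := H.2.2.2
  unfold yonedaCell at H
  generalize L.homFunctor a = Fa at H
  generalize L.homFunctor b = Fb at H
  generalize L.homFunctor c = Fc at H
  cases H with
  | mod _ _ _ _ _ _ _ _ _ H =>
    have H1 := values_of_comp_fn (H ⟨a, ha⟩).2.2.2 0 ⟨_, hL.e_mem_hom ha⟩ ⟨f, hf⟩
      (hL.star_e hf).symm
    exact H1.symm.trans (hL.star_e hh)

/-! ### Surjectivity of the Yoneda map on hom-sets -/

theorem iterate_d_arr_mod {A B : InftyData.{u}} (n : ℕ) (F G : GMap A B) (α : A.cell 0 → B.X) :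
    CatCell.d^[n + 1] (.arr A B (.mod n F G α)) = .arr A B (.fn F) ∧
      CatCell.c^[n + 1] (.arr A B (.mod n F G α)) = .arr A B (.fn G) := by
  induction n generalizing α with
  | zero => exact ⟨rfl, rfl⟩
  | succ n ih => exact ⟨(ih _).1, (ih _).2⟩

/-- The elements of `∞-CAT` in degree `n + 1` with end points `A` and `B` are those of degree `n`
of `∞-CAT(A, B)`. -/
theorem exists_arr_of_dom_cod {A B : InftyData.{u}} {n : ℕ} {x : CatCell.{u}}
    (hx : x ∈ InftyCAT.cell (n + 1)) (hA : CatCell.d^[n + 1] x = .obj A)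
    (hB : CatCell.c^[n + 1] x = .obj B) :
    ∃ t ∈ (FunCat A B B.Sim).cell n, x = .arr A B t := by
  cases x with
  | obj => exact hx.elim
  | arr A' B' t =>
    have ht : CatCell.d^[n + 1] (.arr A' B' t) = .obj A' ∧
        CatCell.c^[n + 1] (.arr A' B' t) = .obj B' := by
      have h := hx.2.2
      cases n with
      | zero =>
        cases t with
        | fn F => exact ⟨rfl, rfl⟩
        | mod => exact h.elim
      | succ n =>
        cases t with
        | fn => exact h.elim
        | mod m F G α =>
          obtain ⟨rfl, -⟩ := h
          rw [Function.iterate_succ_apply' _ (m + 1), Function.iterate_succ_apply' _ (m + 1),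
            (iterate_d_arr_mod _ _ _ _).1, (iterate_d_arr_mod _ _ _ _).2]
          exact ⟨rfl, rfl⟩
    rw [ht.1, CatCell.obj.injEq] at hA
    rw [ht.2, CatCell.obj.injEq] at hB
    subst hA hB
    exact ⟨t, hx.2.2, rfl⟩

theorem iterate_e_arr_mod {A B : InftyData.{u}} (n k : ℕ) (F G : GMap A B) (α : A.cell 0 → B.X) :
    CatCell.e^[k] (.arr A B (.mod n F G α)) =
      .arr A B (.mod (n + k) F G fun a => B.e^[k] (α a)) := by
  induction k with
  | zero => rfl
  | succ k ih =>
    rw [Function.iterate_succ_apply', ih]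
    simp only [Function.iterate_succ_apply']
    rfl

theorem iterate_e_arr_fn {A B : InftyData.{u}} (k : ℕ) (F : GMap A B) :
    CatCell.e^[k + 1] (.arr A B (.fn F)) =
      .arr A B (.mod k F F fun a => B.e^[k + 1] (F 0 a)) := by
  induction k with
  | zero => rfl
  | succ k ih =>
    rw [Function.iterate_succ_apply', ih]
    simp only [Function.iterate_succ_apply']
    rfl

end InftyData

theorem IsModification.isNatural {L : InftyData.{u}} {K : InftyData.{v}} {R : K.X → K.X → Prop}
    {F G : GMap L K} {n : ℕ} {α : L.cell 0 → K.X} (h : IsModification L K R F G n α) :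
    IsNatural L K R F G n α := by
  cases n with
  | zero => exact h
  | succ n => exact h.1

/-- The families of extremal functors of an `n`-modification are `0`-modifications. -/
theorem IsModification.iterate {L : InftyData.{u}} {K : InftyData.{v}} {R : K.X → K.X → Prop}
    {F G : GMap L K} {n : ℕ} {α : L.cell 0 → K.X} (h : IsModification L K R F G n α) :
    IsNatural L K R F G 0 (fun a => K.d^[n] (α a)) ∧
      IsNatural L K R F G 0 (fun a => K.c^[n] (α a)) := by
  induction n generalizing α with
  | zero => exact ⟨h, h⟩
  | succ n ih => exact ⟨(ih h.2.1).1, (ih h.2.2).2⟩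

namespace InftyData

variable {L : InftyData.{u}}

/-- The naturality of a modification `α` from `L(-, a)` to `L(-, b)` at `h`, evaluated at the
identity `e a`. If `eᵏ α(x)` and `eᵏ α(a)` have components `ρ` and `ρ'`, the left hand side is the
composite of `ρ(c h)` and `G(h)`, and the right hand side is that of `e H'(e a) * h` and
`ρ'(e a) * e d h` (with iterated faces and identities). The two composites are equivalent. -/
theorem eval_natural (hL : L.IsStrict) {a b x : L.X} (ha : a ∈ L.cell 0) (hx : x ∈ L.cell 0)
    {ν k N : ℕ} {α : L.Op.cell 0 → CatCell.{u}}
    (hα : IsNatural L.Op InftyCAT.{u} CatCell.Approx (L.homFunctor a) (L.homFunctor b) ν α)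
    (hN : k + ν = N + 1) {h : L.X} (hh : h ∈ (L.Hom x a).cell (N + 1))
    {G H : GMap (L.Hom x a) (L.Hom x b)} {ρ : (L.Hom x a).cell 0 → L.X}
    (hρ : CatCell.e^[k] (α ⟨x, hx⟩) = .arr (L.Hom x a) (L.Hom x b) (.mod N G H ρ))
    {G' H' : GMap (L.Hom a a) (L.Hom a b)} {ρ' : (L.Hom a a).cell 0 → L.X}
    (hρ' : CatCell.e^[k] (α ⟨a, ha⟩) = .arr (L.Hom a a) (L.Hom a b) (.mod N G' H' ρ'))
    (z : (L.Hom x a).cell 0) (hz : z.1 = L.c^[N + 1] h) :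
    ∃ γ γ', (L.Hom x b).IsComp (N + 1) (N + 1) (ρ z) (G (N + 1) ⟨h, hh⟩) γ ∧
      (L.Hom x b).IsComp (N + 1) (N + 1)
        (L.star (N + 1) (L.e^[N + 1] (H' 0 ⟨_, hL.e_mem_hom ha⟩)) h)
        (L.star (N + 1) (ρ' ⟨_, hL.e_mem_hom ha⟩) (L.e^[N + 1] (L.d^[N + 1] h))) γ' ∧
      (L.Hom x b).Sim γ γ' := by
  have hhN : h ∈ L.cell (k + ν + 1) := by
    rw [hN]
    exact hh.1
  have hnat := hα.natural k ⟨a, ha⟩ ⟨x, hx⟩ ⟨h, hhN⟩ (by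
    rw [hL.op_dom hhN, hN]
    exact hh.2.2) (by
    rw [hL.op_cod hhN, hN]
    exact hh.2.1)
  simp only [hN] at hnat
  obtain ⟨p, q, hp, hq, hpq⟩ := hnat
  have hpre : ∀ b, L.homFunctor b (k + ν + 1) ⟨h, hhN⟩ = L.preArr x a b (N + 1) h := fun b =>
    (homFunctor_succ b ⟨h, hhN⟩ (show h ∈ (L.Hom x a).cell (k + ν) by rwa [hN])).trans
      (congrArg (fun m => L.preArr x a b m h) hN)
  have hρ'' : InftyCAT.e^[k] (α ⟨a, ha⟩) = _ := hρ'
  have hρ₁ : InftyCAT.e^[k] (α ⟨x, hx⟩) = _ := hρ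
  rw [hpre a, hρ₁] at hp
  rw [hpre b, hρ''] at hq
  obtain ⟨P, Q, γ, rfl, hγ⟩ := components_of_comp_mod hp.2.2.2
  obtain ⟨P', Q', γ', rfl, hγ'⟩ := components_of_comp_mod hq.2.2.2
  obtain ⟨-, hG', hH', hmod⟩ := hq.1.2.1.2.2
  have hh0 : h ∈ (L.Hom x a).cell (0 + (N + 1)) := by rwa [Nat.zero_add]
  refine ⟨_, _, hγ ⟨_, hL.e_mem_hom ha⟩ z ⟨h, hh⟩ ?_ ?_,
    hγ' ⟨_, hL.e_mem_hom ha⟩ ⟨_, hH'.mem 0 ⟨_, hL.e_mem_hom ha⟩⟩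
      ⟨_, hmod.isNatural.mem ⟨_, hL.e_mem_hom ha⟩⟩ rfl rfl, sim_of_approx_mod hpq _⟩
  · exact hz.trans (hL.e_star ((hL.hom x a).iterate_c_mem hh0)).symm
  · exact (hL.e_star hh).symm

/-- A `0`-modification `L(-, a) → L(-, b)` is represented by an element of `L⁰(a, b)`. -/
theorem exists_eq_postArr_zero (hL : L.IsStrict) {a b : L.X} (ha : a ∈ L.cell 0)
    {α : L.Op.cell 0 → CatCell.{u}}
    (hα : IsNatural L.Op InftyCAT.{u} CatCell.Approx (L.homFunctor a) (L.homFunctor b) 0 α) :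
    ∃ f ∈ (L.Hom a b).cell 0, ∀ x, α x = L.postArr x.1 a b 0 f := by
  have hT : ∀ x : L.Op.cell 0, ∃ T : GMap (L.Hom x.1 a) (L.Hom x.1 b),
      IsFunctor _ _ (L.Hom x.1 b).Sim T ∧ α x = .arr _ _ (.fn T) := by
    intro x
    obtain ⟨t, ht, hx⟩ := exists_arr_of_dom_cod (hα.mem x) (hα.dom x) (hα.cod x)
    cases t with
    | fn T => exact ⟨T, ht, hx⟩
    | mod => exact ht.elim
  choose T hTf hT using hT
  have hea := hL.e_mem_hom ha
  refine ⟨T ⟨a, ha⟩ 0 ⟨_, hea⟩, (hTf _).mem _ _, fun x => ?_⟩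
  have hf := (hTf ⟨a, ha⟩).mem 0 ⟨_, hea⟩
  generalize hfT : T ⟨a, ha⟩ 0 ⟨_, hea⟩ = f at hf ⊢
  rw [hT]
  refine congrArg (CatCell.arr _ _) (congrArg FunCell.fn ?_)
  funext k g
  have hB := hL.isBifunctor_star x a b
  have hA := hL.hom x.1 a
  have hg0 : g.1 ∈ (L.Hom x.1 a).cell (0 + k) := by
    rw [Nat.zero_add]
    exact g.2
  have hge := hA.e_mem _ _ g.2
  have hfk : L.e^[k] f ∈ (L.Hom a b).cell k := by simpa using (hL.hom a b).iterate_e_mem k hf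
  have hc : L.c^[k + 1] (L.e g.1) = L.c^[k] g.1 := by
    rw [Function.iterate_succ_apply, hL.c_e _ _ g.2.1]
  have hd : L.d^[k + 1] (L.e g.1) = L.d^[k] g.1 := by
    rw [Function.iterate_succ_apply, hL.d_e _ _ g.2.1]
  have hdg : L.d^[k] g.1 ∈ (L.Hom x.1 a).cell 0 := hA.iterate_d_mem hg0
  -- Naturality is used at `e g` instead of `g`: in this degree both sides are single elements, and
  -- equivalent elements have the same domain.
  obtain ⟨γ, γ', hγ, hγ', hs⟩ := eval_natural (N := k) hL ha x.2 hα rfl hge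
    (by rw [hT]; exact iterate_e_arr_fn _ _) (by rw [hT]; exact iterate_e_arr_fn _ _)
    ⟨L.c^[k] g.1, hA.iterate_c_mem hg0⟩ hc.symm
  have h1 : γ = T x (k + 1) ⟨L.e g.1, hge⟩ :=
    (hL.hom x.1 b).eq_of_id_comp ((hTf x).mem _ _) hγ
  have h2 : γ' = L.star (k + 1) (L.e^[k + 1] f) (L.e g.1) := by
    have h3 := hB.iterate_e (k + 1) hf hdg
    rw [Nat.zero_add] at h3
    rw [hfT, hd, ← h3] at hγ'
    exact (hL.hom x.1 b).eq_of_comp_id (hB.mem _ _ _ hf hdg) hγ'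
  have h4 := hB.map_e _ _ _ hfk g.2
  rw [← Function.iterate_succ_apply' L.e k f] at h4
  have h5 := (hL.hom x.1 b).d_eq_of_sim hγ.1.2.2 hs
  rw [h1, h2, ← h4] at h5
  exact ((hTf x).map_d k ⟨L.e g.1, hge⟩ g (hA.d_e _ _ g.2).symm).trans
    (h5.trans ((hL.hom x.1 b).d_e _ _ (hB.mem _ _ _ hfk g.2)))

/-- An `n`-modification `L(-, a) → L(-, b)` is represented by an element of `Lⁿ(a, b)`. -/
theorem exists_eq_postArr (hL : L.IsStrict) {a b : L.X} (ha : a ∈ L.cell 0) {n : ℕ}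
    {α : L.Op.cell 0 → CatCell.{u}}
    (hα : IsModification L.Op InftyCAT.{u} CatCell.Approx (L.homFunctor a) (L.homFunctor b) n α) :
    ∃ f ∈ (L.Hom a b).cell n, ∀ x, α x = L.postArr x.1 a b n f := by
  cases n with
  | zero => exact exists_eq_postArr_zero hL ha hα
  | succ n =>
    obtain ⟨φ, hφ, hφα⟩ := exists_eq_postArr_zero hL ha hα.iterate.1
    obtain ⟨ψ, hψ, hψα⟩ := exists_eq_postArr_zero hL ha hα.iterate.2
    -- the components are modifications between the functors `L(x, φ)` and `L(x, ψ)`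
    have hβ : ∀ x : L.Op.cell 0, ∃ β : (L.Hom x.1 a).cell 0 → L.X,
        IsModification _ _ (L.Hom x.1 b).Sim
          (sectionFn (L.Hom x a) (L.Hom a b) (L.Hom x b) (fun n g f => L.star n f g) φ)
          (sectionFn (L.Hom x a) (L.Hom a b) (L.Hom x b) (fun n g f => L.star n f g) ψ) n β ∧
        α x = .arr _ _ (.mod n
          (sectionFn (L.Hom x a) (L.Hom a b) (L.Hom x b) (fun n g f => L.star n f g) φ)
          (sectionFn (L.Hom x a) (L.Hom a b) (L.Hom x b) (fun n g f => L.star n f g) ψ) β) := by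
      intro x
      obtain ⟨t, ht, hx⟩ := exists_arr_of_dom_cod (hα.1.mem x) (hα.1.dom x) (hα.1.cod x)
      cases t with
      | fn T => exact ht.elim
      | mod m F G β =>
        obtain ⟨rfl, -, -, hβ⟩ := ht
        have h1 := hφα x
        have h2 := hψα x
        rw [hx] at h1 h2
        replace h1 := (iterate_d_arr_mod m F G β).1.symm.trans h1
        replace h2 := (iterate_d_arr_mod m F G β).2.symm.trans h2
        simp only [postArr, sectionArr, sectionCell, CatCell.arr.injEq, heq_eq_eq, true_and,
          FunCell.fn.injEq] at h1 h2
        subst h1 h2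
        exact ⟨β, hβ, hx⟩
    choose β hβm hβ using hβ
    have hea := hL.e_mem_hom ha
    have hf := (hβm ⟨a, ha⟩).isNatural.mem ⟨_, hea⟩
    have hdf := (hβm ⟨a, ha⟩).isNatural.dom ⟨_, hea⟩
    have hcf := (hβm ⟨a, ha⟩).isNatural.cod ⟨_, hea⟩
    generalize hfβ : β ⟨a, ha⟩ ⟨_, hea⟩ = f at hf hdf hcf
    replace hdf : L.d^[n + 1] f = φ := hdf.trans (hL.star_e hφ)
    replace hcf : L.c^[n + 1] f = ψ := hcf.trans (hL.star_e hψ)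
    refine ⟨f, hf, fun x => ?_⟩
    rw [hβ]
    refine congrArg (CatCell.arr _ _) ?_
    simp only [sectionCell]
    rw [hdf, hcf]
    refine congrArg (FunCell.mod n _ _) (funext fun g => ?_)
    have hB := hL.isBifunctor_star x a b
    have hA := hL.hom x.1 a
    have hgn : L.e^[n + 1] g.1 ∈ (L.Hom x.1 a).cell (n + 1) := by
      simpa using hA.iterate_e_mem (n + 1) g.2
    have hge : L.e^[n + 2] g.1 ∈ (L.Hom x.1 a).cell (n + 2) := by
      simpa using hA.iterate_e_mem (n + 2) g.2
    -- Naturality is used at `eⁿ⁺² g`, one degree higher than needed for an equivalence between the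
    -- two sides, so that taking domains turns it into an equality.
    obtain ⟨γ, γ', hγ, hγ', hs⟩ := eval_natural (N := n + 1) (k := 1) hL ha x.2 hα.1
      (Nat.add_comm _ _) hge
      (by rw [hβ]; exact iterate_e_arr_mod _ 1 _ _ _)
      (by rw [hβ]; exact iterate_e_arr_mod _ 1 _ _ _)
      g (hA.iterate_c_iterate_e_self (n + 2) g.2).symm
    have hstar : ∀ {y}, y ∈ (L.Hom a b).cell 0 →
        L.star (n + 2) (L.e^[n + 2] y) (L.e^[n + 2] g.1) = L.e^[n + 2] (L.star 0 y g.1) := by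
      intro y hy
      have := hB.iterate_e (n + 2) hy g.2
      rw [Nat.zero_add] at this
      exact this.symm
    have h1 : γ = L.e (β x g) := by
      simp only [sectionFn] at hγ
      rw [hstar hφ] at hγ
      exact (hL.hom x.1 b).eq_of_comp_id (hB.mem _ _ _ hφ g.2) hγ
    have h2 : γ' = L.e (L.star (n + 1) f (L.e^[n + 1] g.1)) := by
      have h3 := hB.map_e _ _ _ hf hgn
      rw [← Function.iterate_succ_apply' L.e (n + 1)] at h3
      have h4 : L.d^[n + 2] (L.e^[n + 2] g.1) = g.1 := hA.iterate_d_iterate_e_self (n + 2) g.2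
      have h5 : sectionFn (L.Hom a a) (L.Hom a b) (L.Hom a b) (fun n g f => L.star n f g) ψ 0
        ⟨_, hea⟩ = ψ := hL.star_e hψ
      rw [h4, h5, hfβ, hstar hψ] at hγ'
      exact ((hL.hom x.1 b).eq_of_id_comp (hB.mem _ _ _ hψ g.2) hγ').trans h3.symm
    have h5 := (hL.hom x.1 b).d_eq_of_sim hγ.1.2.2 hs
    rw [h1, h2] at h5
    exact ((hL.hom x.1 b).d_e _ _ ((hβm x).isNatural.mem g)).symm.trans
      (h5.trans ((hL.hom x.1 b).d_e _ _ (hB.mem _ _ _ hf hgn)))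

end InftyData

/-! ### Strict isomorphisms and equivalences -/

namespace InftyData

/-- The relation `∼` is itself a family of equivalence data. -/
theorem isSimulation_sim (L : InftyData.{u}) : L.IsSimulation L.Sim := by
  rintro x y ⟨R, hR, hxy⟩
  obtain ⟨n, f, g, p, q, h1, h2, h3, h4, h5, h6, h7⟩ := hR x y hxy
  exact ⟨n, f, g, p, q, h1, h2, h3, h4, h5, ⟨R, hR, h6⟩, ⟨R, hR, h7⟩⟩

end InftyData

/-- Strict functors preserve equivalences. -/
theorem IsFunctor.map_sim {L : InftyData.{u}} {K : InftyData.{v}} {F : GMap L K}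
    (hL : L.IsStrict) (hF : IsFunctor L K Eq F) {n : ℕ} {x y : L.cell n} (h : L.Sim x y) :
    K.Sim (F n x) (F n y) := by
  refine ⟨fun X Y => ∃ n, ∃ x y : L.cell n, L.Sim x y ∧ X = F n x ∧ Y = F n y, ?_,
    n, x, y, h, rfl, rfl⟩
  rintro _ _ ⟨n, x, y, h, rfl, rfl⟩
  obtain ⟨m, f, g, p, q, ⟨hx, -⟩, ⟨hf, hdf, hcf⟩, ⟨hg, hdg, hcg⟩, hp, hq, hxp, hqy⟩ :=
    L.isSimulation_sim _ _ h
  obtain rfl := hL.deg_unique _ _ _ x.2 hx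
  obtain ⟨_, hp', rfl⟩ := hF.map_comp _ _ ⟨g, hg⟩ ⟨f, hf⟩ ⟨p, hp.1.2.2⟩ hp
  obtain ⟨_, hq', rfl⟩ := hF.map_comp _ _ ⟨f, hf⟩ ⟨g, hg⟩ ⟨q, hq.1.2.2⟩ hq
  exact ⟨n, F _ ⟨f, hf⟩, F _ ⟨g, hg⟩, _, _, ⟨hF.mem _ x, hF.mem _ y⟩,
    ⟨hF.mem _ _, (hF.map_d _ ⟨f, hf⟩ x hdf.symm).symm, (hF.map_c _ ⟨f, hf⟩ y hcf.symm).symm⟩,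
    ⟨hF.mem _ _, (hF.map_d _ ⟨g, hg⟩ y hdg.symm).symm, (hF.map_c _ ⟨g, hg⟩ x hcg.symm).symm⟩,
    hp', hq', ⟨_, ⟨_, hL.e_mem _ _ x.2⟩, ⟨p, hp.1.2.2⟩, hxp, (hF.map_e _ x _ rfl).symm, rfl⟩,
    ⟨_, ⟨q, hq.1.2.2⟩, ⟨_, hL.e_mem _ _ y.2⟩, hqy, rfl, (hF.map_e _ y _ rfl).symm⟩⟩

/-- A strict functor that is bijective on cells and reflects composites is a strict isomorphism. -/
theorem IsFunctor.isStrictIso {L : InftyData.{u}} {K : InftyData.{v}} {F : GMap L K}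
    {G : GMap K L} (hL : L.IsStrict) (hF : IsFunctor L K Eq F)
    (hinj : ∀ n (x y : L.cell n), F n x = F n y → x.1 = y.1)
    (hcomp : ∀ n k (x y z : L.cell n), K.IsComp n k (F n x) (F n y) (F n z) →
      L.IsComp n k x y z)
    (hG : ∀ n (y : K.cell n), ∃ x : L.cell n, F n x = y.1 ∧ G n y = x.1) :
    IsStrictIso L K F G := by
  choose g hFg hGg using hG
  have hGF : ∀ n (x : L.cell n) (y : K.cell n), y.1 = F n x → G n y = x.1 := fun n x y hy =>
    (hGg n y).trans (hinj n _ _ ((hFg n y).trans hy))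
  refine ⟨hF, ⟨fun n y => ?_, fun n x y hy => ?_, fun n x y hy => ?_, fun n x y hy => ?_,
    fun n k x y z h => ?_⟩, hGF, fun n y x hx => ?_⟩
  · rw [hGg]
    exact (g n y).2
  · rw [hGg (n + 1) x]
    exact hGF n ⟨_, hL.d_mem _ _ (g (n + 1) x).2⟩ y
      (by rw [hy, hF.map_d n (g (n + 1) x) _ rfl, hFg])
  · rw [hGg (n + 1) x]
    exact hGF n ⟨_, hL.c_mem _ _ (g (n + 1) x).2⟩ y
      (by rw [hy, hF.map_c n (g (n + 1) x) _ rfl, hFg])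
  · rw [hGg n x]
    exact hGF (n + 1) ⟨_, hL.e_mem _ _ (g n x).2⟩ y
      (by rw [hy, hF.map_e n (g n x) _ rfl, hFg])
  · refine ⟨_, ?_, rfl⟩
    rw [hGg, hGg, hGg]
    refine hcomp n k _ _ _ ?_
    rwa [hFg, hFg, hFg]
  · rw [← hFg n y]
    exact congrArg (F n) (Subtype.ext (hx.trans (hGg n y)))

namespace InftyData

variable {L : InftyData.{u}}

theorem iterate_d_mod {K : InftyData.{v}} (n : ℕ) (F G : GMap L K) (α : L.cell 0 → K.X) :
    FunCell.d^[n + 1] (.mod n F G α) = .fn F ∧ FunCell.c^[n + 1] (.mod n F G α) = .fn G := by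
  induction n generalizing α with
  | zero => exact ⟨rfl, rfl⟩
  | succ n ih => exact ⟨(ih _).1, (ih _).2⟩

theorem funCell_deg_unique {K : InftyData.{v}} {R : K.X → K.X → Prop} {m n : ℕ} {x : FunCell L K}
    (hm : FunCell.IsCell R m x) (hn : FunCell.IsCell R n x) : m = n := by
  cases x with
  | fn F =>
    cases m with
    | succ => exact hm.elim
    | zero =>
      cases n with
      | succ => exact hn.elim
      | zero => rfl
  | mod k F G α =>
    cases m with
    | zero => exact hm.elim
    | succ m =>
      cases n with
      | zero => exact hn.elim
      | succ n => rw [← hm.1, ← hn.1]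

theorem funCell_faces_comp {K : InftyData.{v}} {R : K.X → K.X → Prop} {n k : ℕ}
    {x y z : FunCell L K} (hz : FunCell.IsCell R (n + 1) z) (h : FunCell.Comp k x y z) :
    FunCell.d^[n + 1] z = FunCell.d^[n + 1] y ∧ FunCell.c^[n + 1] z = FunCell.c^[n + 1] x := by
  cases h with
  | mod m =>
    obtain ⟨rfl, -⟩ := hz
    simp only [iterate_d_mod, and_self]

/-- The Yoneda map is surjective on hom-sets. -/
theorem IsStrict.exists_eq_yonedaCell (hL : L.IsStrict) {a b : L.X} (ha : a ∈ L.cell 0) {n : ℕ}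
    {τ : FunCell L.Op InftyCAT.{u}} (hτ : τ ∈ L.Presheaf.cell (n + 1))
    (hd : FunCell.d^[n + 1] τ = .fn (L.homFunctor a))
    (hc : FunCell.c^[n + 1] τ = .fn (L.homFunctor b)) :
    ∃ f ∈ (L.Hom a b).cell n, τ = L.yonedaCell a b n f := by
  cases τ with
  | fn => exact hτ.elim
  | mod m F G α =>
    obtain ⟨rfl, -, -, hα⟩ := hτ
    rw [(iterate_d_mod _ _ _ _).1, FunCell.fn.injEq] at hd
    rw [(iterate_d_mod _ _ _ _).2, FunCell.fn.injEq] at hc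
    subst hd hc
    obtain ⟨f, hf, hαf⟩ := exists_eq_postArr hL ha hα
    exact ⟨f, hf, congrArg (FunCell.mod m _ _) (funext hαf)⟩

theorem IsStrict.unitValue_yonedaCell (hL : L.IsStrict) (a b : L.cell 0) {n : ℕ} {f : L.X}
    (hf : f ∈ (L.Hom a.1 b.1).cell n) : L.UnitValue a b (L.yonedaCell a b n f) f := by
  have hs := hL.star_e hf
  cases n with
  | zero =>
    have := UnitValue.fn (a := a) (b := b) (L.homFunctor a) (L.homFunctor b)
      (fun x => L.postArr x.1 a b 0 f) _ ⟨_, hL.e_mem_hom a.2⟩ rfl rfl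
    exact hs.subst (motive := L.UnitValue a b (L.yonedaCell a b 0 f)) this
  | succ n =>
    have := UnitValue.mod (a := a) (b := b) n (L.homFunctor a) (L.homFunctor b)
      (fun x => L.postArr x.1 a b (n + 1) f) _ _ _ ⟨_, hL.e_mem_hom a.2⟩ rfl rfl
    exact hs.subst (motive := L.UnitValue a b (L.yonedaCell a b (n + 1) f)) this

theorem IsStrict.isFunctor_yonedaHom (hL : L.IsStrict) (a b : L.cell 0) :
    IsFunctor (L.Hom a.1 b.1) (L.Presheaf.Hom (L.yoneda 0 a) (L.yoneda 0 b)) Eq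
      (L.yonedaHom a b) := by
  have hY := hL.isFunctor_yoneda
  have hmem : ∀ n (x : (L.Hom a.1 b.1).cell n),
      L.yonedaHom a b n x ∈ (L.Presheaf.Hom (L.yoneda 0 a) (L.yoneda 0 b)).cell n := by
    intro n x
    refine ⟨hY.mem _ _, ?_⟩
    rw [yonedaHom, yoneda_succ (L := L) _ x.2]
    exact iterate_d_mod _ _ _ _
  refine ⟨hmem, fun n x y hy => hY.map_d _ ⟨x.1, x.2.1⟩ ⟨y.1, y.2.1⟩ hy,
    fun n x y hy => hY.map_c _ ⟨x.1, x.2.1⟩ ⟨y.1, y.2.1⟩ hy,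
    fun n x y hy => hY.map_e _ ⟨x.1, x.2.1⟩ ⟨y.1, y.2.1⟩ hy, fun n k x y z H => ?_⟩
  obtain ⟨_, h, rfl⟩ :=
    hY.map_comp _ _ ⟨x.1, x.2.1⟩ ⟨y.1, y.2.1⟩ ⟨z.1, z.2.1⟩ H.to_hom
  exact ⟨_, ⟨⟨hmem n x, hmem n y, hmem n z⟩, H.2.1, h.2.2⟩, rfl⟩

theorem IsStrict.exists_isStrictIso_yonedaHom (hL : L.IsStrict) (a b : L.cell 0) :
    ∃ ev : GMap (L.Presheaf.Hom (L.yoneda 0 a) (L.yoneda 0 b)) (L.Hom a.1 b.1),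
      (∀ n τ, L.UnitValue a b τ.1 (ev n τ)) ∧
      IsStrictIso (L.Hom a.1 b.1) (L.Presheaf.Hom (L.yoneda 0 a) (L.yoneda 0 b))
        (L.yonedaHom a b) ev := by
  have h : ∀ n (τ : (L.Presheaf.Hom (L.yoneda 0 a) (L.yoneda 0 b)).cell n),
      ∃ f ∈ (L.Hom a.1 b.1).cell n, τ.1 = L.yonedaCell a b n f := fun n τ =>
    hL.exists_eq_yonedaCell a.2 τ.2.1 τ.2.2.1 τ.2.2.2
  choose ev hev hτ using h
  have hY : ∀ n (x : (L.Hom a.1 b.1).cell n), L.yonedaHom a b n x = L.yonedaCell a b n x :=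
    fun n x => yoneda_succ (L := L) ⟨x.1, x.2.1⟩ x.2
  refine ⟨ev, fun n τ => ?_, (hL.isFunctor_yonedaHom a b).isStrictIso (hL.hom _ _) ?_ ?_ ?_⟩
  · rw [hτ]
    exact hL.unitValue_yonedaCell a b (hev n τ)
  · intro n x y h
    rw [hY, hY] at h
    exact hL.yonedaCell_injective a.2 x.2 y.2 h
  · intro n k x y z H
    have H' := H.to_hom
    rw [hY, hY, hY] at H'
    exact hL.isComp_of_yonedaCell a.2 x.2 y.2 z.2 H.2.1.2 H'
  · intro n τ
    exact ⟨⟨ev n τ, hev n τ⟩, (hY _ _).trans (hτ n τ).symm, rfl⟩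

/-- The Yoneda map reflects equivalences: equivalence data in `∞-CAT^{Lᵒᵖ}` between elements of its
image consist of elements of its image, since it is surjective on hom-sets. -/
theorem IsStrict.sim_of_sim_yoneda (hL : L.IsStrict) {m n : ℕ} {x : L.cell m} {y : L.cell n}
    (h : L.Presheaf.Sim (L.yoneda m x) (L.yoneda n y)) : L.Sim x.1 y.1 := by
  have hY := hL.isFunctor_yoneda
  refine ⟨fun x y => ∃ m n, ∃ (hx : x ∈ L.cell m) (hy : y ∈ L.cell n),
    L.Presheaf.Sim (L.yoneda m ⟨x, hx⟩) (L.yoneda n ⟨y, hy⟩), ?_, m, n, x.2, y.2, h⟩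
  clear h
  rintro x y ⟨m, n, hx, hy, h⟩
  obtain ⟨l, F, G, P, Q, ⟨hxl, hyl⟩, ⟨hF, hdF, hcF⟩, ⟨hG, hdG, hcG⟩, hP, hQ, hxP, hQy⟩ :=
    L.Presheaf.isSimulation_sim _ _ h
  obtain rfl := funCell_deg_unique (hY.mem _ _) hxl
  obtain rfl := funCell_deg_unique (hY.mem _ _) hyl
  have hPf := funCell_faces_comp hP.1.2.2 hP.2.2.2
  have hQf := funCell_faces_comp hQ.1.2.2 hQ.2.2.2
  -- it suffices to represent the equivalence data by elements of `L`
  suffices ∃ f g p q : L.cell (n + 1), (L.d f = x ∧ L.c f = y) ∧ (L.d g = y ∧ L.c g = x) ∧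
      L.IsComp (n + 1) 1 g f p ∧ L.IsComp (n + 1) 1 f g q ∧
      P = L.yoneda (n + 1) p ∧ Q = L.yoneda (n + 1) q by
    obtain ⟨f, g, p, q, hf, hg, hp, hq, rfl, rfl⟩ := this
    rw [← hY.map_e n ⟨x, hx⟩ ⟨_, hL.e_mem _ _ hx⟩ rfl] at hxP
    rw [← hY.map_e n ⟨y, hy⟩ ⟨_, hL.e_mem _ _ hy⟩ rfl] at hQy
    exact ⟨n, f, g, p, q, ⟨hx, hy⟩, ⟨f.2, hf⟩, ⟨g.2, hg⟩, hp, hq, ⟨_, _, _, p.2, hxP⟩,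
      ⟨_, _, q.2, _, hQy⟩⟩
  cases n with
  | zero =>
    obtain ⟨f, hf, rfl⟩ := hL.exists_eq_yonedaCell hx hF hdF hcF
    obtain ⟨g, hg, rfl⟩ := hL.exists_eq_yonedaCell hy hG hdG hcG
    obtain ⟨p, hp, rfl⟩ := hL.exists_eq_yonedaCell hx hP.1.2.2 (hPf.1.trans hdF)
      (hPf.2.trans hcG)
    obtain ⟨q, hq, rfl⟩ := hL.exists_eq_yonedaCell hy hQ.1.2.2 (hQf.1.trans hdG)
      (hQf.2.trans hcF)
    have h1 := hL.star_eq_of_yonedaCell hx hf hp hP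
    have h2 := hL.star_eq_of_yonedaCell hy hg hq hQ
    exact ⟨⟨f, hf.1⟩, ⟨g, hg.1⟩, ⟨p, hp.1⟩, ⟨q, hq.1⟩, hf.2, hg.2, h1 ▸ hL.isComp_star hg hf,
      h2 ▸ hL.isComp_star hf hg, (yoneda_succ (L := L) ⟨p, hp.1⟩ hp).symm,
      (yoneda_succ (L := L) ⟨q, hq.1⟩ hq).symm⟩
  | succ n =>
    have ha : L.d^[n + 1] x ∈ L.cell 0 := hL.iterate_d_mem (by rwa [Nat.zero_add])
    have hxh := mem_hom_self hx
    generalize L.d^[n + 1] x = a at ha hxh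
    generalize L.c^[n + 1] x = b at hxh
    have hx' := yoneda_succ (L := L) ⟨x, hx⟩ hxh
    have hFd : FunCell.d^[n + 2] F = .fn (L.homFunctor a) := by
      rw [Function.iterate_succ_apply, show F.d = _ from hdF, hx']
      exact (iterate_d_mod _ _ _ _).1
    -- `d F = L(-, x)` already determines the end points of `F`
    have hFc : FunCell.c^[n + 2] F = .fn (L.homFunctor b) := by
      cases F with
      | fn => exact hF.elim
      | mod k F F' α =>
        obtain ⟨rfl, -⟩ := hF
        have hdF' := congrArg FunCell.c^[n + 1] (hdF.trans hx')
        rw [yonedaCell, (iterate_d_mod _ _ _ _).2] at hdF'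
        rw [(iterate_d_mod _ _ _ _).2, ← hdF']
        exact (iterate_d_mod _ _ _ _).2.symm
    obtain ⟨f, hf, rfl⟩ := hL.exists_eq_yonedaCell ha hF hFd hFc
    rw [← yoneda_succ (L := L) ⟨f, hf.1⟩ hf] at hdF hcF
    rw [← hY.map_d _ ⟨f, hf.1⟩ ⟨_, hL.d_mem _ _ hf.1⟩ rfl] at hdF
    rw [← hY.map_c _ ⟨f, hf.1⟩ ⟨_, hL.c_mem _ _ hf.1⟩ rfl] at hcF
    have hdf : L.d f = x := hL.yoneda_injective _ _ _ _ hdF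
    have hcf : L.c f = y := hL.yoneda_injective _ _ _ _ hcF
    have hyh : y ∈ (L.Hom a b).cell n := hcf ▸ hL.hom_c_mem hf
    have hy' := yoneda_succ (L := L) ⟨y, hy⟩ hyh
    have hGd : FunCell.d^[n + 2] G = .fn (L.homFunctor a) := by
      rw [Function.iterate_succ_apply, show G.d = _ from hdG, hy']
      exact (iterate_d_mod _ _ _ _).1
    have hGc : FunCell.c^[n + 2] G = .fn (L.homFunctor b) := by
      rw [Function.iterate_succ_apply, show G.c = _ from hcG, hx']
      exact (iterate_d_mod _ _ _ _).2
    obtain ⟨g, hg, rfl⟩ := hL.exists_eq_yonedaCell ha hG hGd hGc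
    rw [← yoneda_succ (L := L) ⟨g, hg.1⟩ hg] at hdG hcG
    rw [← hY.map_d _ ⟨g, hg.1⟩ ⟨_, hL.d_mem _ _ hg.1⟩ rfl] at hdG
    rw [← hY.map_c _ ⟨g, hg.1⟩ ⟨_, hL.c_mem _ _ hg.1⟩ rfl] at hcG
    obtain ⟨p, hp, rfl⟩ := hL.exists_eq_yonedaCell ha hP.1.2.2 (hPf.1.trans hFd)
      (hPf.2.trans hGc)
    obtain ⟨q, hq, rfl⟩ := hL.exists_eq_yonedaCell ha hQ.1.2.2 (hQf.1.trans hGd)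
      (hQf.2.trans hFc)
    exact ⟨⟨f, hf.1⟩, ⟨g, hg.1⟩, ⟨p, hp.1⟩, ⟨q, hq.1⟩, ⟨hdf, hcf⟩,
      ⟨hL.yoneda_injective _ _ _ _ hdG, hL.yoneda_injective _ _ _ _ hcG⟩,
      (hL.isComp_of_yonedaCell ha hg hf hp (Nat.le_add_left 1 n) hP).to_hom,
      (hL.isComp_of_yonedaCell ha hf hg hq (Nat.le_add_left 1 n) hQ).to_hom,
      (yoneda_succ (L := L) ⟨p, hp.1⟩ hp).symm, (yoneda_succ (L := L) ⟨q, hq.1⟩ hq).symm⟩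

end InftyData

theorem proposition3p4 (L : InftyData.{u}) (hL : L.IsStrict) :
    -- the Yoneda map is a (strict) functor into presheaves of categories
    IsFunctor L L.Presheaf Eq L.yoneda ∧
    -- it is an embedding
    (∀ (m n : ℕ) (x : L.cell m) (y : L.cell n), L.yoneda m x = L.yoneda n y → x.1 = y.1) ∧
    -- on hom-sets it is a strict isomorphism with inverse the Yoneda isomorphism
    (∀ a b : L.cell 0,
      ∃ ev : GMap (L.Presheaf.Hom (L.yoneda 0 a) (L.yoneda 0 b)) (L.Hom a.1 b.1),
        (∀ n τ, L.UnitValue a b τ.1 (ev n τ)) ∧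
        IsStrictIso (L.Hom a.1 b.1) (L.Presheaf.Hom (L.yoneda 0 a) (L.yoneda 0 b))
          (L.yonedaHom a b) ev) ∧
    -- it preserves and reflects equivalences
    (∀ (m n : ℕ) (x : L.cell m) (y : L.cell n),
      L.Sim x.1 y.1 ↔ L.Presheaf.Sim (L.yoneda m x) (L.yoneda n y)) := by
  refine ⟨hL.isFunctor_yoneda, hL.yoneda_injective, hL.exists_isStrictIso_yonedaHom,
    fun m n x y => ⟨fun h => ?_, hL.sim_of_sim_yoneda⟩⟩
  obtain ⟨l, -, -, -, -, ⟨hx, hy⟩, -⟩ := L.isSimulation_sim _ _ h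
  obtain rfl := hL.deg_unique _ _ _ x.2 hx
  obtain rfl := hL.deg_unique _ _ _ y.2 hy
  exact hL.isFunctor_yoneda.map_sim hL h
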